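/- Let $d\in\mathbb N$, $d\ge 1$, let $r>1$, and let $\mu$ be the normalized Lebesgue measure $(2\pi)^{-d}d\mathbf x$ on $\Omega=[0,2\pi]^d$. For $k\in\mathbb Z$ put $k^*:=\max(|k|,1)$, and let $\mathbf E^r$ be the Korobov class of all continuous functions $f:\mathbb R^d\to\mathbb C$, $2\pi$-periodic in each variable, such that $$|\hat f(\mathbf k)|\le\prod_{j=1}^d (k_j^*)^{-r}\quad\text{for all }\mathbf k\in\mathbb Z^d,\qquad \hat f(\mathbf k):=(2\pi)^{-d}\int_{[0,2\pi]^d}f(\mathbf x)e^{-i(\mathbf k,\mathbf x)}\,d\mathbf x .$$ For a class $W$ of functions and $m\in\mathbb N$ let $$er_m^o(W,L_2):=\inf_{\xi^1,\dots,\xi^m\in\Omega;\ \lambda_1,\dots,\lambda_m\in\mathbb R}\ \sup_{f\in W}\left|\int_\Omega |f|^2\,d\mu-\sum_{j=1}^m\lambda_j|f(\xi^j)|^2\right|$$ be the optimal error of discretization of the $L_2$ norm. Then $$er_m^o(\mathbf E^r,L_2)\asymp m^{-r}(\log m)^{d-1},$$ that is, there are constants $0<c\le C$ depending only on $r$ and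 $d$ such that for all integers $m\ge 2$ $$c\,m^{-r}(\log m)^{d-1}\le er_m^o(\mathbf E^r,L_2)\le C\,m^{-r}(\log m)^{d-1}.$$ The same two bounds hold for the subclass of real-valued functions of $\mathbf E^r$ in place of $\mathbf E^r$. -/

import Mathlib

open MeasureTheory Real
open scoped ENNReal

/-- The optimal error `er_m^o(W, L_q)` of discretization of the `L_q(Ω, μ)` norm on the class `W`:
the infimum over knots `ξ^1, …, ξ^m ∈ Ω` and real weights `λ_1, …, λ_m` of
`sup_{f ∈ W} | ‖f‖_q^q - ∑_j λ_j |f(ξ^j)|^q |`. It is taken in `[0, ∞]`, where every infimum and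
supremum exists. -/
noncomputable def optimalDiscretizationError {X : Type*} [MeasurableSpace X] (Ω : Set X)
    (μ : Measure X) (q : ℝ) (W : Set (X → ℂ)) (m : ℕ) : ℝ≥0∞ :=
  ⨅ (ξ : Fin m → Ω) (w : Fin m → ℝ), ⨆ f ∈ W,
    ENNReal.ofReal |(∫ x, ‖f x‖ ^ q ∂μ) - ∑ j, w j * ‖f (ξ j)‖ ^ q|

/-- The cube `[0, 2π]^d`. -/
def cube (d : ℕ) : Set (Fin d → ℝ) :=
  Set.Icc (fun _ => 0) (fun _ => 2 * π)

/-- The normalized Lebesgue measure `(2π)^{-d} dx` on the cube `[0, 2π]^d`. -/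
noncomputable def cubeMeasure (d : ℕ) : Measure (Fin d → ℝ) :=
  (ENNReal.ofReal ((2 * π) ^ d))⁻¹ • volume.restrict (cube d)

/-- The Fourier coefficient `f̂(k) = (2π)^{-d} ∫_{[0,2π]^d} f(x) e^{-i(k,x)} dx`. -/
noncomputable def fourierCoefficient {d : ℕ} (f : (Fin d → ℝ) → ℂ) (k : Fin d → ℤ) : ℂ :=
  ∫ x, f x * Complex.exp (-Complex.I * ((∑ j, (k j : ℝ) * x j : ℝ) : ℂ)) ∂(cubeMeasure d)

/-- The Korobov class `E^r`: continuous functions, `2π`-periodic in each variable, with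
`|f̂(k)| ≤ ∏_j (k_j^*)^{-r}` for all `k ∈ ℤ^d`, where `k^* = max(|k|, 1)`. -/
def korobovClass (d : ℕ) (r : ℝ) : Set ((Fin d → ℝ) → ℂ) :=
  {f | Continuous f ∧
    (∀ j : Fin d, Function.Periodic f (Pi.single j (2 * π))) ∧
    ∀ k : Fin d → ℤ, ‖fourierCoefficient f k‖ ≤ ∏ j, (max |(k j : ℝ)| 1) ^ (-r)}

/-- The real-valued functions of the Korobov class `E^r`. -/
def realKorobovClass (d : ℕ) (r : ℝ) : Set ((Fin d → ℝ) → ℂ) :=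
  {f | f ∈ korobovClass d r ∧ ∀ x, (f x).im = 0}

/-- The measure `cubeMeasure d` is a probability measure. -/
theorem isProbabilityMeasure_cubeMeasure (d : ℕ) : IsProbabilityMeasure (cubeMeasure d) := by
  have hpos : (0 : ℝ) < (2 * π) ^ d := by positivity
  refine ⟨?_⟩
  have h : volume (cube d) = ENNReal.ofReal ((2 * π) ^ d) := by
    rw [cube, Real.volume_Icc_pi]
    simp [ENNReal.ofReal_pow Real.two_pi_pos.le]
  rw [cubeMeasure, Measure.smul_apply, Measure.restrict_apply_univ, h, smul_eq_mul]
  exact ENNReal.inv_mul_cancel (by simpa using hpos) ENNReal.ofReal_ne_top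

/-! Upper bound: Frolov's cubature. An irreducible monic integer polynomial of degree `d` with `d`
real roots gives, through its Vandermonde matrix, a lattice `B ℤ^d` whose nonzero points have
coordinate product at least `1` in absolute value (`exists_matrix_one_le_prod_abs`). Dilate it by
`2^(n/d)` and use the points of the dual lattice as knots, weighted by a smooth compactly supported
bump whose integer translates sum to `1`. By Poisson summation the rule sends `e^{i(k,x)}` to the
sum over `l` of the bump's transform at `k - Bl`. The term `l = 0` is exactly the integral, and the
remaining terms are the error (`enorm_latticeRule_expMode_sub_le`).

Since `|f|²` is an absolutely convergent double Fourier series, its error is a triple sum of Korobov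
weights over `k`, `m` and `l ≠ 0`. The weight reproduces itself under convolution, up to a constant,
because `r > 1`. Summing out `k` and then `m` leaves only the weight summed over the nonzero lattice
points (`latticeRule_norm_sq_error_le`). Counting these points in dyadic boxes bounds this sum by a
constant times `2^{-rn} (n+1)^{d-1}` (`exists_tsum_lattice_korobovWeight_le`).

Lower bound: given `m < 2^n` knots and any `s` with `∑ s_j = n`, a dimension count gives a
trigonometric polynomial with frequencies in a dyadic box of size `2^s` that vanishes at all knots.
Its squared modulus is nonnegative with mean `1` after normalization. Adding these over all `s`, of
which there are about `n^{d-1}`, and scaling by about `2^{-rn}` gives a function `g ≥ 0` in the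
class with large mean (`exists_fooling_function`). The functions `1/2` and `(1+g)/2` look alike at
the knots, while the integrals of their squares differ by at least half the mean of `g`. No weights
can therefore serve both (`ofReal_le_optimalDiscretizationError`). The test functions are real, so
the bound holds for the smaller class and passes to the larger one by monotonicity. -/

open Polynomial in
/-- The monic integer polynomial `∏_{i<d} (X - 4i) - 1`, irreducible with `d` real roots. -/
noncomputable def frolovPoly (d : ℕ) : ℤ[X] :=
  ∏ i ∈ Finset.range d, (X - C (4 * (i : ℤ))) - 1

/-! ### Frolov's polynomial and its norm bound -/

section FrolovPoly
open Polynomial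

theorem natDegree_prod_frolov (d : ℕ) :
    (∏ i ∈ Finset.range d, (X - C (4 * (i : ℤ)))).natDegree = d := by
  rw [natDegree_prod_of_monic _ _ (fun i _ => monic_X_sub_C _)]
  simp only [natDegree_X_sub_C, Finset.sum_const, Finset.card_range, smul_eq_mul, mul_one]

theorem monic_frolovPoly {d : ℕ} (hd : 1 ≤ d) : (frolovPoly d).Monic := by
  have h := monic_prod_of_monic (Finset.range d) (fun i : ℕ => X - C (4 * (i : ℤ)))
    (fun i _ => monic_X_sub_C _)
  refine h.sub_of_left ?_
  rw [degree_one, degree_eq_natDegree h.ne_zero, natDegree_prod_frolov]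
  exact_mod_cast hd

theorem natDegree_frolovPoly {d : ℕ} (hd : 1 ≤ d) : (frolovPoly d).natDegree = d := by
  rw [frolovPoly, natDegree_sub_eq_left_of_natDegree_lt, natDegree_prod_frolov]
  rw [natDegree_one, natDegree_prod_frolov]; exact hd

theorem eval_frolovPoly (d : ℕ) (x : ℤ) :
    (frolovPoly d).eval x = ∏ i ∈ Finset.range d, (x - 4 * (i : ℤ)) - 1 := by
  rw [frolovPoly, eval_sub, eval_prod, eval_one]
  simp only [eval_sub, eval_X, eval_C]

/-- At each of the `d` points `4i` the polynomial equals `-1`, so two integer factors take opposite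
values `±1` there. The sum of two proper monic factors then has `d` zeros and degree below `d`. It
vanishes, which contradicts monicity. -/
theorem irreducible_frolovPoly {d : ℕ} (hd : 1 ≤ d) : Irreducible (frolovPoly d) := by
  have hm := monic_frolovPoly hd
  rw [hm.irreducible_iff_natDegree']
  refine ⟨fun h => ?_, fun f g hf hg hfg hmem => ?_⟩
  · have := natDegree_frolovPoly hd
    rw [h, natDegree_one] at this; omega
  · rw [natDegree_frolovPoly hd, Finset.mem_Ioc] at hmem
    have hdeg : f.natDegree + g.natDegree = d := by
      rw [← hf.natDegree_mul hg, hfg, natDegree_frolovPoly hd]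
    have h0 : f + g = 0 := by
      refine eq_zero_of_natDegree_lt_card_of_eval_eq_zero (f + g)
        (f := fun i : Fin d => 4 * ((i : ℕ) : ℤ)) ?_ ?_ ?_
      · intro i j hij
        apply Fin.ext
        simp only at hij
        omega
      · intro i
        have h1 : f.eval (4 * ((i : ℕ) : ℤ)) * g.eval (4 * ((i : ℕ) : ℤ)) = -1 := by
          rw [← eval_mul, hfg, eval_frolovPoly,
            Finset.prod_eq_zero (Finset.mem_range.2 i.2) (sub_self _)]
          norm_num
        rw [eval_add]
        rcases Int.mul_eq_neg_one_iff_eq_one_or_neg_one.1 h1 with h | h <;> rw [h.1, h.2] <;> norm_num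
      · rw [Fintype.card_fin]
        refine (natDegree_add_le _ _).trans_lt ?_
        rw [max_lt_iff]; omega
    have h1 : f = -g := eq_neg_of_add_eq_zero_left h0
    have h2 := hf.leadingCoeff
    rw [h1, leadingCoeff_neg, hg.leadingCoeff] at h2
    norm_num at h2

/-- Between the two midpoints only the factor with `i = j` changes sign. -/
theorem prod_sub_four_mul_neg (d j : ℕ) (hj : j < d) :
    (∏ i ∈ Finset.range d, ((4 * (j : ℤ) - 2) - 4 * (i : ℤ))) *
      (∏ i ∈ Finset.range d, ((4 * ((j + 1 : ℕ) : ℤ) - 2) - 4 * (i : ℤ))) < 0 := by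
  rw [← Finset.prod_mul_distrib, ← Finset.mul_prod_erase _ _ (Finset.mem_range.2 hj)]
  refine mul_neg_of_neg_of_pos ?_ (Finset.prod_pos fun i hi => ?_)
  · push_cast; nlinarith
  · have hne : (j : ℤ) ≠ i := by
      intro h; exact (Finset.mem_erase.1 hi).1 (by exact_mod_cast h.symm)
    push_cast
    rcases lt_or_gt_of_ne hne with h | h
    · have h1 : (4 * (j : ℤ) - 2) - 4 * (i : ℤ) < 0 := by omega
      have h2 : (4 * ((j : ℤ) + 1) - 2) - 4 * (i : ℤ) < 0 := by omega
      exact mul_pos_of_neg_of_neg h1 h2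
    · have h1 : 0 < (4 * (j : ℤ) - 2) - 4 * (i : ℤ) := by omega
      have h2 : 0 < (4 * ((j : ℤ) + 1) - 2) - 4 * (i : ℤ) := by omega
      exact mul_pos h1 h2

/-- The product is even. Hence subtracting `1` from it cannot destroy a sign, and the alternating
signs survive in `frolovPoly`. -/
theorem prod_sub_four_mul_ne_one {d : ℕ} (hd : 1 ≤ d) (j : ℕ) :
    (∏ i ∈ Finset.range d, ((4 * (j : ℤ) - 2) - 4 * (i : ℤ))) ≠ 1 := by
  intro h
  have h1 : (2 : ℤ) ∣ ∏ i ∈ Finset.range d, ((4 * (j : ℤ) - 2) - 4 * (i : ℤ)) :=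
    Dvd.dvd.trans (by omega) (Finset.dvd_prod_of_mem _ (Finset.mem_range.2 (show 0 < d by omega)))
  rw [h] at h1
  norm_num at h1

theorem exists_root_frolovPoly {d : ℕ} (hd : 1 ≤ d) (j : ℕ) (hj : j < d) :
    ∃ x : ℝ, 4 * (j : ℝ) - 2 < x ∧ x < 4 * ((j + 1 : ℕ) : ℝ) - 2 ∧
      ((frolovPoly d).map (Int.castRingHom ℝ)).eval x = 0 := by
  set P := (frolovPoly d).map (Int.castRingHom ℝ) with hP
  have hev : ∀ k : ℕ, P.eval (4 * (k : ℝ) - 2) =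
      ((∏ i ∈ Finset.range d, ((4 * (k : ℤ) - 2) - 4 * (i : ℤ)) - 1 : ℤ) : ℝ) := by
    intro k
    have h : (4 * (k : ℝ) - 2) = Int.castRingHom ℝ (4 * (k : ℤ) - 2) := by simp
    rw [hP, h, eval_map_apply, eval_frolovPoly]
    rfl
  have hneg := prod_sub_four_mul_neg d j hj
  have hn1 := prod_sub_four_mul_ne_one hd j
  have hn2 := prod_sub_four_mul_ne_one hd (j + 1)
  have e1 := hev j
  have e2 := hev (j + 1)
  set u := ∏ i ∈ Finset.range d, ((4 * (j : ℤ) - 2) - 4 * (i : ℤ)) with hu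
  set v := ∏ i ∈ Finset.range d, ((4 * ((j + 1 : ℕ) : ℤ) - 2) - 4 * (i : ℤ)) with hv
  have hab : 4 * (j : ℝ) - 2 ≤ 4 * ((j + 1 : ℕ) : ℝ) - 2 := by push_cast; linarith
  rcases mul_neg_iff.1 hneg with ⟨h1, h2⟩ | ⟨h1, h2⟩
  · have hu' : (0 : ℝ) < ((u - 1 : ℤ) : ℝ) := by
      exact_mod_cast (by omega : 0 < u - 1)
    have hv' : ((v - 1 : ℤ) : ℝ) < 0 := by
      exact_mod_cast (by omega : v - 1 < 0)
    obtain ⟨x, hx, hx0⟩ := intermediate_value_Ioo' hab P.continuous.continuousOn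
      (show (0 : ℝ) ∈ Set.Ioo _ _ from ⟨by rw [e2]; exact hv', by rw [e1]; exact hu'⟩)
    exact ⟨x, hx.1, hx.2, hx0⟩
  · have hu' : ((u - 1 : ℤ) : ℝ) < 0 := by
      exact_mod_cast (by omega : u - 1 < 0)
    have hv' : (0 : ℝ) < ((v - 1 : ℤ) : ℝ) := by
      exact_mod_cast (by omega : 0 < v - 1)
    obtain ⟨x, hx, hx0⟩ := intermediate_value_Ioo hab P.continuous.continuousOn
      (show (0 : ℝ) ∈ Set.Ioo _ _ from ⟨by rw [e1]; exact hu', by rw [e2]; exact hv'⟩)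
    exact ⟨x, hx.1, hx.2, hx0⟩

theorem exists_roots_frolovPoly {d : ℕ} (hd : 1 ≤ d) :
    ∃ x : Fin d → ℝ, Function.Injective x ∧
      (frolovPoly d).map (Int.castRingHom ℝ) = ∏ j, (X - C (x j)) := by
  choose x hx1 hx2 hx0 using fun j : Fin d => exists_root_frolovPoly hd j j.2
  have hmono : StrictMono x := by
    intro i j hij
    have h : ((i : ℕ) + 1 : ℕ) ≤ (j : ℕ) := hij
    have h' : (((i : ℕ) + 1 : ℕ) : ℝ) ≤ ((j : ℕ) : ℝ) := by exact_mod_cast h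
    linarith [hx2 i, hx1 j]
  refine ⟨x, hmono.injective, ?_⟩
  have hm := (monic_frolovPoly hd).map (Int.castRingHom ℝ)
  have hm' := monic_prod_of_monic Finset.univ (fun j => X - C (x j)) (fun i _ => monic_X_sub_C _)
  have hdeg : ((frolovPoly d).map (Int.castRingHom ℝ)).natDegree = d := by
    rw [(monic_frolovPoly hd).natDegree_map, natDegree_frolovPoly hd]
  have hdeg' : (∏ j, (X - C (x j))).natDegree = d := by
    rw [natDegree_prod_of_monic _ _ (fun i _ => monic_X_sub_C _)]
    simp only [natDegree_X_sub_C, Finset.sum_const, Finset.card_univ, Fintype.card_fin,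
      smul_eq_mul, mul_one]
  rw [← sub_eq_zero]
  by_contra hne
  refine hne (eq_zero_of_natDegree_lt_card_of_eval_eq_zero _ hmono.injective (fun j => ?_) ?_)
  · rw [eval_sub, hx0, eval_prod, Finset.prod_eq_zero (Finset.mem_univ j) (by simp), sub_zero]
  · rw [Fintype.card_fin]
    have h1 := degree_sub_lt_left (p := (frolovPoly d).map (Int.castRingHom ℝ))
      (q := ∏ j, (X - C (x j)))
      (by rw [degree_eq_natDegree hm.ne_zero, degree_eq_natDegree hm'.ne_zero, hdeg, hdeg'])
      hm.ne_zero (by rw [hm.leadingCoeff, hm'.leadingCoeff])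
    rw [degree_eq_natDegree hm.ne_zero, hdeg, degree_eq_natDegree hne] at h1
    exact_mod_cast h1

/-- The product over the roots is a resultant of integer polynomials, hence an integer. It is
nonzero because an irreducible polynomial is coprime over `ℚ` to any nonzero polynomial of smaller
degree. -/
theorem one_le_abs_prod_eval_frolovPoly {d : ℕ} (hd : 1 ≤ d) {x : Fin d → ℝ}
    (hx : (frolovPoly d).map (Int.castRingHom ℝ) = ∏ j, (X - C (x j)))
    {p : ℤ[X]} (hp0 : p ≠ 0) (hp : p.natDegree < d) :
    1 ≤ |∏ j, (p.map (Int.castRingHom ℝ)).eval (x j)| := by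
  have hm := monic_frolovPoly hd
  have hres : ∏ j, (p.map (Int.castRingHom ℝ)).eval (x j) =
      ((resultant (frolovPoly d) p (frolovPoly d).natDegree d : ℤ) : ℝ) := by
    have h := resultant_map_map (frolovPoly d) p (frolovPoly d).natDegree d (Int.castRingHom ℝ)
    have hspl : ((frolovPoly d).map (Int.castRingHom ℝ)).Splits := by
      rw [hx]; exact Splits.prod fun i _ => Splits.X_sub_C _
    have h2 := resultant_eq_prod_eval ((frolovPoly d).map (Int.castRingHom ℝ))
      (p.map (Int.castRingHom ℝ)) d (natDegree_map_le.trans hp.le) hspl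
    rw [(hm.map _).leadingCoeff, one_pow, one_mul, hm.natDegree_map, h] at h2
    rw [← eq_intCast (Int.castRingHom ℝ), h2, hx]
    have h3 := roots_multiset_prod_X_sub_C (Finset.univ.val.map x)
    rw [Multiset.map_map] at h3
    change _ = (Multiset.map _ (Multiset.map (fun j => X - C (x j)) Finset.univ.val).prod.roots).prod
    rw [show (fun j => X - C (x j)) = (fun a => X - C a) ∘ x from rfl, h3, Multiset.map_map]
    rfl
  have hne : ∏ j, (p.map (Int.castRingHom ℝ)).eval (x j) ≠ 0 := by
    rw [Finset.prod_ne_zero_iff]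
    intro j _ hj
    have hirr : Irreducible ((frolovPoly d).map (Int.castRingHom ℚ)) :=
      (hm.irreducible_iff_irreducible_map_fraction_map (K := ℚ)).1 (irreducible_frolovPoly hd)
    have hcop : IsCoprime ((frolovPoly d).map (Int.castRingHom ℚ)) (p.map (Int.castRingHom ℚ)) := by
      refine (EuclideanDomain.dvd_or_coprime _ _ hirr).resolve_left fun hdvd => ?_
      have hp0' : p.map (Int.castRingHom ℚ) ≠ 0 := by
        rwa [Ne, Polynomial.map_eq_zero_iff (RingHom.injective_int _)]
      have := natDegree_le_of_dvd hdvd hp0'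
      rw [hm.natDegree_map, natDegree_frolovPoly hd] at this
      exact absurd (this.trans natDegree_map_le) (not_le.2 hp)
    obtain ⟨a, b, hab⟩ := hcop
    have h := congrArg (fun q : ℚ[X] => (q.map (algebraMap ℚ ℝ)).eval (x j)) hab
    simp only [Polynomial.map_add, Polynomial.map_mul, Polynomial.map_map, eval_add, eval_mul,
      Polynomial.map_one, eval_one] at h
    rw [RingHom.ext_int ((algebraMap ℚ ℝ).comp (Int.castRingHom ℚ)) (Int.castRingHom ℝ), hj, hx,
      eval_prod, Finset.prod_eq_zero (Finset.mem_univ j) (by simp)] at h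
    simp at h
  rw [hres] at hne ⊢
  rw [← Int.cast_abs]
  exact_mod_cast Int.one_le_abs (by exact_mod_cast hne)

end FrolovPoly

/-- A full-rank lattice in `ℝ^d` all of whose nonzero points have `|∏ coordinates| ≥ 1`. -/
theorem exists_matrix_one_le_prod_abs {d : ℕ} (hd : 1 ≤ d) :
    ∃ B : Matrix (Fin d) (Fin d) ℝ, B.det ≠ 0 ∧
      ∀ l : Fin d → ℤ, l ≠ 0 → 1 ≤ ∏ j, |(B.mulVec fun i => (l i : ℝ)) j| := by
  obtain ⟨x, hinj, hx⟩ := exists_roots_frolovPoly hd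
  -- The coordinates of the lattice point indexed by `l` are the values at the roots of the
  -- polynomial with coefficients `l`.
  refine ⟨Matrix.vandermonde x, Matrix.det_vandermonde_ne_zero_iff.2 hinj, fun l hl => ?_⟩
  set p : Polynomial ℤ := ∑ i : Fin d, Polynomial.monomial (i : ℕ) (l i) with hp
  have hcoeff : ∀ i : Fin d, p.coeff i = l i := by
    intro i
    rw [hp, Polynomial.finsetSum_coeff, Finset.sum_eq_single i]
    · simp
    · intro b _ hb
      rw [Polynomial.coeff_monomial, if_neg]
      exact fun h => hb (Fin.ext h)
    · simp
  have hp0 : p ≠ 0 := by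
    intro h
    apply hl
    funext i
    rw [← hcoeff i, h]; simp
  have hdeg : p.natDegree < d := by
    refine lt_of_le_of_lt (b := d - 1) ?_ (by omega)
    refine Polynomial.natDegree_sum_le_of_forall_le _ _ fun i _ => ?_
    exact (Polynomial.natDegree_monomial_le _).trans (by have := i.2; omega)
  have h := one_le_abs_prod_eval_frolovPoly hd hx hp0 hdeg
  rw [Finset.abs_prod] at h
  refine h.trans_eq (Finset.prod_congr rfl fun j _ => ?_)
  congr 1
  rw [hp, Polynomial.map_sum, Polynomial.eval_finsetSum, Matrix.mulVec, dotProduct]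
  refine Finset.sum_congr rfl fun i _ => ?_
  simp [Matrix.vandermonde_apply, mul_comm]

/-! ### The Korobov weight and its convolution inequality -/

/-- The one-dimensional Korobov weight `max(|x|, 1)^{-r}`, with values in `[0, ∞]`. -/
noncomputable def korobovWeight (r x : ℝ) : ℝ≥0∞ :=
  ENNReal.ofReal ((max |x| 1) ^ (-r))

theorem korobovWeight_ne_zero (r x : ℝ) : korobovWeight r x ≠ 0 := by
  have : (0 : ℝ) < max |x| 1 := lt_max_of_lt_right one_pos
  rw [korobovWeight, Ne, ENNReal.ofReal_eq_zero, not_le]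
  exact Real.rpow_pos_of_pos this _

theorem korobovWeight_neg (r x : ℝ) : korobovWeight r (-x) = korobovWeight r x := by
  rw [korobovWeight, korobovWeight, abs_neg]

/-- If `|x| ≤ 2 max(|y|, 1)` then the weight at `y` is at most `2^r` times the weight at `x`. -/
theorem korobovWeight_le_of_abs_le {r : ℝ} (hr : 0 ≤ r) {x y : ℝ} (h : |x| ≤ 2 * max |y| 1) :
    korobovWeight r y ≤ ENNReal.ofReal (2 ^ r) * korobovWeight r x := by
  have hx : (0 : ℝ) < max |x| 1 := lt_max_of_lt_right one_pos
  have hy : (1 : ℝ) ≤ max |y| 1 := le_max_right _ _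
  rw [korobovWeight, korobovWeight, ← ENNReal.ofReal_mul (by positivity)]
  apply ENNReal.ofReal_le_ofReal
  have h1 : max |x| 1 ≤ 2 * max |y| 1 := max_le h (by linarith)
  have h2 := Real.rpow_le_rpow_of_nonpos hx h1 (neg_nonpos.2 hr)
  rw [Real.mul_rpow (by norm_num) (by linarith)] at h2
  calc (max |y| 1) ^ (-r) = 2 ^ r * (2 ^ (-r) * (max |y| 1) ^ (-r)) := by
        rw [← mul_assoc, ← Real.rpow_add (by norm_num), add_neg_cancel, Real.rpow_zero, one_mul]
    _ ≤ 2 ^ r * (max |x| 1) ^ (-r) := by gcongr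

theorem tsum_korobovWeight_ne_top {r : ℝ} (hr : 1 < r) :
    ∑' k : ℤ, korobovWeight r k ≠ ⊤ := by
  have hs : Summable fun k : ℤ => |(k : ℝ)| ^ (-r) + if k = 0 then (1 : ℝ) else 0 :=
    (Real.summable_abs_int_rpow hr).add
      (summable_of_hasFiniteSupport ((Set.finite_singleton (0 : ℤ)).subset fun k hk => by
        by_contra h
        exact hk (if_neg h)))
  refine ne_top_of_le_ne_top hs.tsum_ofReal_ne_top (ENNReal.tsum_le_tsum fun k => ?_)
  apply ENNReal.ofReal_le_ofReal
  by_cases hk : k = 0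
  · subst hk
    have : (0 : ℝ) ≤ |((0 : ℤ) : ℝ)| ^ (-r) := by positivity
    simpa using this
  · have h1 : (1 : ℝ) ≤ |(k : ℝ)| := by exact_mod_cast Int.one_le_abs hk
    rw [max_eq_left h1, if_neg hk, add_zero]

/-- The total mass of the one-dimensional Korobov weight on the integers. -/
noncomputable def korobovMass (r : ℝ) : ℝ≥0∞ := ∑' k : ℤ, korobovWeight r k

/-- Rounding `x` down to an integer moves each argument by less than `1`, which costs at most a
factor `2^r`. After that the sum is a reindexing of the total mass. -/
theorem tsum_korobovWeight_sub_le {r : ℝ} (hr : 1 < r) (x : ℝ) :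
    ∑' k : ℤ, korobovWeight r (x - k) ≤ ENNReal.ofReal (2 ^ r) * korobovMass r := by
  calc ∑' k : ℤ, korobovWeight r (x - k)
      ≤ ∑' k : ℤ, ENNReal.ofReal (2 ^ r) * korobovWeight r ((⌊x⌋ - k : ℤ) : ℝ) := by
        refine ENNReal.tsum_le_tsum fun k => korobovWeight_le_of_abs_le (by linarith) ?_
        push_cast
        have h1 := Int.floor_le x
        have h2 := Int.lt_floor_add_one x
        have h3 : |(⌊x⌋ : ℝ) - k| ≤ |x - k| + 1 := by
          have : (⌊x⌋ : ℝ) - k = (x - k) - (x - ⌊x⌋) := by ring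
          rw [this]
          refine (abs_sub _ _).trans ?_
          gcongr
          rw [abs_le]; constructor <;> linarith
        linarith [le_max_left |x - k| 1, le_max_right |x - k| 1]
    _ = ENNReal.ofReal (2 ^ r) * korobovMass r := by
        rw [ENNReal.tsum_mul_left, korobovMass]
        congr 1
        exact (Equiv.subLeft ⌊x⌋).tsum_eq fun k : ℤ => korobovWeight r (k : ℝ)

/-- The constant of the convolution inequality for the Korobov weight. -/
noncomputable def korobovConvConst (r : ℝ) : ℝ≥0∞ :=
  ENNReal.ofReal (2 ^ r) * (ENNReal.ofReal (2 ^ r) * korobovMass r + korobovMass r)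

theorem korobovConvConst_ne_top {r : ℝ} (hr : 1 < r) : korobovConvConst r ≠ ⊤ := by
  have h : korobovMass r ≠ ⊤ := tsum_korobovWeight_ne_top hr
  rw [korobovConvConst]
  finiteness

/-- One of `|x - k|` and `|k|` is at least `|x|/2`, so its weight is at most `2^r` times the weight
at `x`. The other factor is summed over all `k`. -/
theorem tsum_korobovWeight_conv_le {r : ℝ} (hr : 1 < r) (x : ℝ) :
    ∑' k : ℤ, korobovWeight r (x - k) * korobovWeight r k ≤
      korobovConvConst r * korobovWeight r x := by
  have hr0 : (0 : ℝ) ≤ r := by linarith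
  calc ∑' k : ℤ, korobovWeight r (x - k) * korobovWeight r k
      ≤ ∑' k : ℤ, ENNReal.ofReal (2 ^ r) * korobovWeight r x *
          (korobovWeight r (x - k) + korobovWeight r k) := by
        refine ENNReal.tsum_le_tsum fun k => ?_
        have htri : |x| ≤ |x - k| + |(k : ℝ)| := by
          have := abs_add_le (x - k) (k : ℝ)
          simpa using this
        rcases le_total |x - k| |(k : ℝ)| with h | h
        · have h1 : korobovWeight r k ≤ ENNReal.ofReal (2 ^ r) * korobovWeight r x :=
            korobovWeight_le_of_abs_le hr0 (by linarith [le_max_left |(k : ℝ)| 1])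
          rw [mul_comm (korobovWeight r (x - k)), mul_add]
          exact (mul_le_mul_left h1 _).trans le_self_add
        · have h1 : korobovWeight r (x - k) ≤ ENNReal.ofReal (2 ^ r) * korobovWeight r x :=
            korobovWeight_le_of_abs_le hr0 (by linarith [le_max_left |x - k| 1])
          rw [mul_add]
          exact (mul_le_mul_left h1 _).trans le_add_self
    _ ≤ ENNReal.ofReal (2 ^ r) * korobovWeight r x *
          (ENNReal.ofReal (2 ^ r) * korobovMass r + korobovMass r) := by
        rw [ENNReal.tsum_mul_left, ENNReal.tsum_add]
        gcongr
        · exact tsum_korobovWeight_sub_le hr x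
        · exact le_rfl
    _ = korobovConvConst r * korobovWeight r x := by rw [korobovConvConst]; ring

/-- Summing a product of one-variable functions over `Fin d → ι`. -/
theorem ENNReal.tsum_pi_prod {ι : Type*} {d : ℕ} (f : Fin d → ι → ℝ≥0∞) :
    ∑' k : Fin d → ι, ∏ j, f j (k j) = ∏ j, ∑' i, f j i := by
  induction d with
  | zero => simp
  | succ d ih =>
    rw [← (Fin.consEquiv fun _ => ι).tsum_eq, ENNReal.tsum_prod', Fin.prod_univ_succ, ← ih,
      ← ENNReal.tsum_mul_right]
    refine tsum_congr fun a => ?_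
    rw [← ENNReal.tsum_mul_left]
    refine tsum_congr fun k => ?_
    simp [Fin.prod_univ_succ]

theorem tsum_prod_korobovWeight_conv_le {r : ℝ} (hr : 1 < r) {d : ℕ} (x : Fin d → ℝ) :
    ∑' k : Fin d → ℤ, (∏ j, korobovWeight r (x j - k j)) * ∏ j, korobovWeight r (k j) ≤
      korobovConvConst r ^ d * ∏ j, korobovWeight r (x j) := by
  simp_rw [← Finset.prod_mul_distrib]
  rw [ENNReal.tsum_pi_prod fun j (i : ℤ) => korobovWeight r (x j - i) * korobovWeight r i]
  refine (Finset.prod_le_prod' fun j _ => tsum_korobovWeight_conv_le hr (x j)).trans_eq ?_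
  rw [Finset.prod_mul_distrib, Finset.prod_const, Finset.card_univ, Fintype.card_fin]

theorem tsum_prod_korobovWeight_ne_top {r : ℝ} (hr : 1 < r) (d : ℕ) :
    ∑' k : Fin d → ℤ, ∏ j, korobovWeight r (k j) ≠ ⊤ := by
  rw [ENNReal.tsum_pi_prod fun _ (i : ℤ) => korobovWeight r i]
  exact ENNReal.prod_ne_top fun j _ => tsum_korobovWeight_ne_top hr

/-! ### Counting lattice points in dyadic boxes -/

/-- The first coordinate is determined by the other `d - 1`, each of which is at most `t`. This is
the source of the power of the logarithm in the upper bound. -/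
theorem card_sum_eq_le {d : ℕ} (hd : 1 ≤ d) (t : ℕ) :
    {s : Fin d → ℕ | ∑ j, s j = t}.encard ≤ (((t + 1) ^ (d - 1) : ℕ) : ℕ∞) := by
  obtain ⟨e, rfl⟩ : ∃ e, d = e + 1 := ⟨d - 1, by omega⟩
  have hmaps : Set.MapsTo (fun (s : Fin (e + 1) → ℕ) (i : Fin e) => s i.succ)
      {s : Fin (e + 1) → ℕ | ∑ j, s j = t}
      (↑(Fintype.piFinset fun _ : Fin e => Finset.range (t + 1)) : Set (Fin e → ℕ)) := by
    intro s hs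
    simp only [Finset.mem_coe, Fintype.mem_piFinset, Finset.mem_range]
    intro i
    have := Finset.single_le_sum (f := s) (fun j _ => Nat.zero_le _) (Finset.mem_univ i.succ)
    have hs' : ∑ j, s j = t := hs
    omega
  have hinj : Set.InjOn (fun (s : Fin (e + 1) → ℕ) (i : Fin e) => s i.succ)
      {s : Fin (e + 1) → ℕ | ∑ j, s j = t} := by
    intro s hs s' hs' h
    have hs1 : s 0 + ∑ i : Fin e, s i.succ = t := by rw [← Fin.sum_univ_succ]; exact hs
    have hs2 : s' 0 + ∑ i : Fin e, s' i.succ = t := by rw [← Fin.sum_univ_succ]; exact hs'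
    have h' : ∀ i : Fin e, s i.succ = s' i.succ := fun i => congrFun h i
    have hsum : ∑ i : Fin e, s i.succ = ∑ i : Fin e, s' i.succ := Finset.sum_congr rfl fun i _ => h' i
    funext j
    refine Fin.cases ?_ h' j
    omega
  refine (Set.encard_le_encard_of_injOn hmaps hinj).trans_eq ?_
  rw [Set.encard_coe_eq_coe_finsetCard, Fintype.card_piFinset]
  simp

theorem exists_le_sum_eq {d : ℕ} (s : Fin d → ℕ) (n : ℕ) (hn : n ≤ ∑ j, s j) :
    ∃ s' : Fin d → ℕ, (∀ j, s' j ≤ s j) ∧ ∑ j, s' j = n := by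
  induction n with
  | zero => exact ⟨0, fun j => Nat.zero_le _, by simp⟩
  | succ n ih =>
    obtain ⟨s', h1, h2⟩ := ih (by omega)
    obtain ⟨j, hj⟩ : ∃ j, s' j < s j := by
      by_contra! h
      have := Finset.sum_le_sum fun j (_ : j ∈ Finset.univ) => h j
      omega
    refine ⟨Function.update s' j (s' j + 1), fun i => ?_, ?_⟩
    · by_cases hi : i = j
      · subst hi; simpa using hj
      · simpa [hi] using h1 i
    · rw [Finset.sum_update_of_mem (Finset.mem_univ j)]
      have := Finset.add_sum_erase Finset.univ s' (Finset.mem_univ j)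
      rw [Finset.sdiff_singleton_eq_erase]
      omega

/-- A lattice whose nonzero points have coordinate product at least `2^n` in absolute value has at
most `3^d 2^u` points in a centered dyadic box of volume `2^d 2^(n+u)`. -/
theorem encard_lattice_box_le {d n u : ℕ} (hd : 1 ≤ d) (ξ : (Fin d → ℤ) →+ (Fin d → ℝ))
    (hξ : ∀ l, l ≠ 0 → (2 : ℝ) ^ n ≤ ∏ j, |ξ l j|) (s : Fin d → ℕ) (hs : ∑ j, s j = n + u) :
    {l : Fin d → ℤ | ∀ j, |ξ l j| ≤ 2 ^ s j}.encard ≤ ((3 ^ d * 2 ^ u : ℕ) : ℕ∞) := by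
  -- Cut the box into half-open cells with sides `2^(s' j)` and volume `2^n`. Two points in one cell
  -- would differ by a lattice vector with coordinate product below `2^n`, so each cell holds at
  -- most one point and it suffices to count cells.
  obtain ⟨s', hs', hsum⟩ := exists_le_sum_eq s n (by omega)
  have hmaps : Set.MapsTo (fun (l : Fin d → ℤ) (j : Fin d) => ⌊ξ l j / 2 ^ s' j⌋)
      {l : Fin d → ℤ | ∀ j, |ξ l j| ≤ 2 ^ s j}
      (↑(Fintype.piFinset fun j : Fin d => Finset.Icc (-2 ^ (s j - s' j) : ℤ) (2 ^ (s j - s' j))) :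
        Set (Fin d → ℤ)) := by
    intro l hl
    simp only [Finset.mem_coe, Fintype.mem_piFinset, Finset.mem_Icc]
    intro j
    have hl' := abs_le.1 (hl j)
    have hpow : (2 : ℝ) ^ s j = 2 ^ (s j - s' j) * 2 ^ s' j := by
      rw [← pow_add, Nat.sub_add_cancel (hs' j)]
    have hpos : (0 : ℝ) < 2 ^ s' j := by positivity
    constructor
    · rw [Int.le_floor, le_div_iff₀ hpos]
      push_cast
      linarith [hl'.1]
    · have h1 : ξ l j / 2 ^ s' j ≤ ((2 ^ (s j - s' j) : ℤ) : ℝ) := by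
        rw [div_le_iff₀ hpos]
        push_cast
        linarith [hl'.2]
      have h2 := (Int.floor_le (ξ l j / 2 ^ s' j)).trans h1
      exact_mod_cast h2
  have hinj : Function.Injective (fun (l : Fin d → ℤ) (j : Fin d) => ⌊ξ l j / 2 ^ s' j⌋) := by
    intro l l' h
    by_contra hne
    have h1 := hξ (l - l') (sub_ne_zero.2 hne)
    have h2 : ∏ j, |ξ (l - l') j| < ∏ j : Fin d, (2 : ℝ) ^ s' j := by
      have hlt : ∀ j, |ξ (l - l') j| < 2 ^ s' j := by
        intro j
        have h3 := Int.abs_sub_lt_one_of_floor_eq_floor (congrFun h j)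
        have hpos : (0 : ℝ) < 2 ^ s' j := by positivity
        rw [← sub_div, abs_div, abs_of_pos hpos, div_lt_one hpos] at h3
        rwa [map_sub, Pi.sub_apply]
      have hpos : 0 < ∏ j, |ξ (l - l') j| := lt_of_lt_of_le (by positivity) h1
      refine Finset.prod_lt_prod_of_nonempty (fun j _ => ?_) (fun j _ => hlt j)
        ⟨⟨0, hd⟩, Finset.mem_univ _⟩
      exact lt_of_le_of_ne (abs_nonneg _)
        (Ne.symm ((Finset.prod_ne_zero_iff.1 hpos.ne') j (Finset.mem_univ j)))
    rw [Finset.prod_pow_eq_pow_sum, hsum] at h2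
    exact absurd h1 (not_le.2 h2)
  refine (Set.encard_le_encard_of_injOn hmaps hinj.injOn).trans ?_
  rw [Set.encard_coe_eq_coe_finsetCard, Fintype.card_piFinset]
  norm_cast
  have hcard : ∀ j : Fin d, (Finset.Icc (-2 ^ (s j - s' j) : ℤ) (2 ^ (s j - s' j))).card ≤
      3 * 2 ^ (s j - s' j) := by
    intro j
    rw [Int.card_Icc]
    have h1 : 1 ≤ 2 ^ (s j - s' j) := Nat.one_le_two_pow
    have h2 : ((2 : ℤ) ^ (s j - s' j)) = ((2 ^ (s j - s' j) : ℕ) : ℤ) := by push_cast; rfl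
    rw [h2]
    omega
  refine (Finset.prod_le_prod' fun j _ => hcard j).trans_eq ?_
  rw [Finset.prod_mul_distrib, Finset.prod_const, Finset.card_univ, Fintype.card_fin,
    Finset.prod_pow_eq_pow_sum, Finset.sum_tsub_distrib _ fun j _ => hs' j, hsum, hs,
    Nat.add_sub_cancel_left]

/-- The least `s` with `|x| ≤ 2^s` also satisfies `2^s ≤ 2 max(|x|, 1)`, so replacing `x` by `2^s`
costs only a factor `2^r`. -/
theorem exists_dyadic_korobovWeight_le {r : ℝ} (hr : 0 ≤ r) (x : ℝ) :
    ∃ s : ℕ, |x| ≤ 2 ^ s ∧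
      korobovWeight r x ≤ ENNReal.ofReal (2 ^ r) * ENNReal.ofReal (2 ^ (-r)) ^ s := by
  refine ⟨Nat.clog 2 ⌈|x|⌉₊, ?_, ?_⟩
  · have h := Nat.le_pow_clog (b := 2) one_lt_two ⌈|x|⌉₊
    calc |x| ≤ (⌈|x|⌉₊ : ℝ) := Nat.le_ceil _
      _ ≤ _ := by exact_mod_cast h
  · set s := Nat.clog 2 ⌈|x|⌉₊ with hs
    have h2 : |(2 : ℝ) ^ s| ≤ 2 * max |x| 1 := by
      rw [abs_of_pos (by positivity)]
      rcases Nat.eq_zero_or_pos s with h | h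
      · rw [h]; have := le_max_right |x| 1; linarith
      · have h3 : 2 ^ s.pred < ⌈|x|⌉₊ := Nat.pow_pred_clog_lt_self one_lt_two
          (by
            by_contra! hle
            rw [hs, Nat.clog_of_right_le_one hle] at h
            exact lt_irrefl _ h)
        have h4 := Nat.lt_ceil.1 h3
        have h5 : (2 : ℝ) ^ s = 2 * 2 ^ s.pred := by
          rw [← pow_succ', ← Nat.succ_eq_add_one, Nat.succ_pred_eq_of_pos h]
        push_cast at h4
        rw [h5]
        linarith [le_max_left |x| 1]
    refine (korobovWeight_le_of_abs_le hr h2).trans_eq ?_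
    have h1 : (1 : ℝ) ≤ 2 ^ s := one_le_pow₀ one_le_two
    rw [korobovWeight, abs_of_pos (by positivity), max_eq_left h1,
      ← ENNReal.ofReal_pow (by positivity), ← Real.rpow_natCast, ← Real.rpow_natCast,
      ← Real.rpow_mul (by norm_num), ← Real.rpow_mul (by norm_num)]
    ring_nf

theorem tsum_indicator_const_le {α : Type*} (S : Set α) (c : ℝ≥0∞) (N : ℕ)
    (hS : S.encard ≤ N) : ∑' a, S.indicator (fun _ => c) a ≤ N * c := by
  rw [← tsum_subtype S fun _ => c, ENNReal.tsum_set_const]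
  gcongr
  exact_mod_cast hS

/-- The product condition forces the dyadic exponents of a nonzero point to have sum `n + u` with `u
≥ 0`. For each `u` there are at most `(n+u+1)^(d-1)` boxes, each with at most `3^d 2^u` points of
weight of order `2^(-r(n+u))`. The sum over `u` converges because `r > 1`. -/
theorem exists_tsum_lattice_korobovWeight_le {d : ℕ} (hd : 1 ≤ d) {r : ℝ} (hr : 1 < r) :
    ∃ C : ℝ≥0∞, C ≠ ⊤ ∧ ∀ (n : ℕ) (ξ : (Fin d → ℤ) →+ (Fin d → ℝ)),
      (∀ l, l ≠ 0 → (2 : ℝ) ^ n ≤ ∏ j, |ξ l j|) →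
      ∑' l : Fin d → ℤ, (if l = 0 then 0 else ∏ j, korobovWeight r (ξ l j)) ≤
        C * (ENNReal.ofReal (2 ^ (-r)) ^ n * ((n + 1 : ℕ) : ℝ≥0∞) ^ (d - 1)) := by
  set ρ : ℝ≥0∞ := ENNReal.ofReal (2 ^ (-r)) with hρ
  set c : ℝ≥0∞ := ENNReal.ofReal (2 ^ r) ^ d with hc
  set M : ℝ≥0∞ := ∑' u : ℕ, ((u + 1 : ℕ) : ℝ≥0∞) ^ (d - 1) * (2 ^ u * ρ ^ u) with hM
  have hMtop : M ≠ ⊤ := by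
    have hq : 2 * (2 : ℝ) ^ (-r) < 1 := by
      rw [show (2 : ℝ) * 2 ^ (-r) = 2 ^ (1 + -r) by rw [Real.rpow_add (by norm_num), Real.rpow_one]]
      exact Real.rpow_lt_one_of_one_lt_of_neg one_lt_two (by linarith)
    have hq0 : 0 < 2 * (2 : ℝ) ^ (-r) := by positivity
    have hs := summable_pow_mul_geometric_of_norm_lt_one (R := ℝ) (d - 1)
      (r := 2 * (2 : ℝ) ^ (-r)) (by rwa [Real.norm_of_nonneg hq0.le])
    have hs' := ((summable_nat_add_iff 1).2 hs).mul_left (2 * (2 : ℝ) ^ (-r))⁻¹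
    refine ne_top_of_le_ne_top hs'.tsum_ofReal_ne_top (ENNReal.tsum_le_tsum fun u => le_of_eq ?_)
    have h2 : (2 : ℝ≥0∞) = ENNReal.ofReal 2 := by simp
    rw [hρ, ← mul_pow, h2, ← ENNReal.ofReal_mul (by norm_num), ← ENNReal.ofReal_pow hq0.le,
      ← ENNReal.ofReal_natCast, ← ENNReal.ofReal_pow (by positivity),
      ← ENNReal.ofReal_mul (by positivity)]
    congr 1
    rw [pow_succ]
    field_simp
  refine ⟨c * 3 ^ d * M, by rw [hc]; finiteness, fun n ξ hξ => ?_⟩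
  let A : ℕ → Set (Fin d → ℕ) := fun u => {s | ∑ j, s j = n + u}
  let S : (Fin d → ℕ) → Set (Fin d → ℤ) := fun s => {l | ∀ j, |ξ l j| ≤ 2 ^ s j}
  have hpt : ∀ l : Fin d → ℤ, (if l = 0 then 0 else ∏ j, korobovWeight r (ξ l j)) ≤
      ∑' u : ℕ, ∑' s : Fin d → ℕ,
        (A u).indicator (fun s => (S s).indicator (fun _ => c * ρ ^ (n + u)) l) s := by
    intro l
    split_ifs with hl
    · exact zero_le
    choose s hs1 hs2 using fun j => exists_dyadic_korobovWeight_le (r := r) (by linarith) (ξ l j)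
    have hsum : n ≤ ∑ j, s j := by
      have h1 := (hξ l hl).trans (Finset.prod_le_prod (fun j _ => abs_nonneg _) fun j _ => hs1 j)
      rw [Finset.prod_pow_eq_pow_sum] at h1
      exact (pow_le_pow_iff_right₀ one_lt_two).1 h1
    obtain ⟨u, hu⟩ := Nat.exists_eq_add_of_le hsum
    refine le_trans ?_ (ENNReal.le_tsum u)
    refine le_trans ?_ (ENNReal.le_tsum s)
    rw [Set.indicator_of_mem (show s ∈ A u from hu), Set.indicator_of_mem (show l ∈ S s from hs1)]
    refine (Finset.prod_le_prod' fun j _ => hs2 j).trans_eq ?_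
    rw [Finset.prod_mul_distrib, Finset.prod_const, Finset.card_univ, Fintype.card_fin,
      Finset.prod_pow_eq_pow_sum, hu]
  have hcount : ∀ u : ℕ, ∑' l : Fin d → ℤ, ∑' s : Fin d → ℕ,
      (A u).indicator (fun s => (S s).indicator (fun _ => c * ρ ^ (n + u)) l) s ≤
      (((n + u + 1) ^ (d - 1) : ℕ) : ℝ≥0∞) * (((3 ^ d * 2 ^ u : ℕ) : ℝ≥0∞) * (c * ρ ^ (n + u))) := by
    intro u
    rw [ENNReal.tsum_comm]
    refine le_trans (ENNReal.tsum_le_tsum fun s => ?_) (tsum_indicator_const_le (A u) _ _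
      (card_sum_eq_le hd (n + u)))
    by_cases hs : s ∈ A u
    · simp only [Set.indicator_of_mem hs]
      exact tsum_indicator_const_le _ _ _ (encard_lattice_box_le hd ξ hξ s hs)
    · simp only [Set.indicator_of_notMem hs, tsum_zero, le_refl]
  calc ∑' l : Fin d → ℤ, (if l = 0 then 0 else ∏ j, korobovWeight r (ξ l j))
      ≤ ∑' l : Fin d → ℤ, ∑' u : ℕ, ∑' s : Fin d → ℕ,
        (A u).indicator (fun s => (S s).indicator (fun _ => c * ρ ^ (n + u)) l) s :=
        ENNReal.tsum_le_tsum hpt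
    _ ≤ ∑' u : ℕ, (((n + u + 1) ^ (d - 1) : ℕ) : ℝ≥0∞) *
          (((3 ^ d * 2 ^ u : ℕ) : ℝ≥0∞) * (c * ρ ^ (n + u))) := by
        rw [ENNReal.tsum_comm]
        exact ENNReal.tsum_le_tsum hcount
    _ ≤ ∑' u : ℕ, c * 3 ^ d * (ρ ^ n * ((n + 1 : ℕ) : ℝ≥0∞) ^ (d - 1)) *
          (((u + 1 : ℕ) : ℝ≥0∞) ^ (d - 1) * (2 ^ u * ρ ^ u)) := by
        refine ENNReal.tsum_le_tsum fun u => ?_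
        -- The bound `n + u + 1 ≤ (n + 1)(u + 1)` separates `n` from the summation over `u`.
        have h1 : (((n + u + 1) ^ (d - 1) : ℕ) : ℝ≥0∞) ≤
            ((n + 1 : ℕ) : ℝ≥0∞) ^ (d - 1) * ((u + 1 : ℕ) : ℝ≥0∞) ^ (d - 1) := by
          rw [← mul_pow]
          exact_mod_cast Nat.pow_le_pow_left (by nlinarith) _
        refine (mul_le_mul_left h1 _).trans_eq ?_
        push_cast
        ring
    _ = c * 3 ^ d * M * (ρ ^ n * ((n + 1 : ℕ) : ℝ≥0∞) ^ (d - 1)) := by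
        rw [ENNReal.tsum_mul_left, ← hM]; ring

/-! ### Exponentials, the torus and Fourier series -/

/-- The exponential `e^{i(k,x)}`. -/
noncomputable def expMode {d : ℕ} (k : Fin d → ℤ) (x : Fin d → ℝ) : ℂ :=
  Complex.exp (Complex.I * ((∑ j, (k j : ℝ) * x j : ℝ) : ℂ))

theorem norm_expMode {d : ℕ} (k : Fin d → ℤ) (x : Fin d → ℝ) : ‖expMode k x‖ = 1 := by
  rw [expMode, mul_comm, Complex.norm_exp_ofReal_mul_I]

theorem expMode_zero {d : ℕ} (x : Fin d → ℝ) : expMode 0 x = 1 := by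
  simp [expMode]

theorem expMode_add {d : ℕ} (k l : Fin d → ℤ) (x : Fin d → ℝ) :
    expMode (k + l) x = expMode k x * expMode l x := by
  rw [expMode, expMode, expMode, ← Complex.exp_add, ← mul_add, ← Complex.ofReal_add,
    ← Finset.sum_add_distrib]
  simp only [Pi.add_apply, Int.cast_add, add_mul]

theorem expMode_neg {d : ℕ} (k : Fin d → ℤ) (x : Fin d → ℝ) :
    expMode (-k) x = starRingEnd ℂ (expMode k x) := by
  rw [expMode, expMode, ← Complex.exp_conj, map_mul, Complex.conj_I, Complex.conj_ofReal]
  simp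

theorem expMode_neg_eq {d : ℕ} (k : Fin d → ℤ) (x : Fin d → ℝ) :
    expMode (-k) x = Complex.exp (-Complex.I * ((∑ j, (k j : ℝ) * x j : ℝ) : ℂ)) := by
  rw [expMode]
  congr 1
  simp

theorem expMode_mul_conj {d : ℕ} (k l : Fin d → ℤ) (x : Fin d → ℝ) :
    expMode k x * starRingEnd ℂ (expMode l x) = expMode (k - l) x := by
  rw [← expMode_neg, ← expMode_add, sub_eq_add_neg]

theorem continuous_expMode {d : ℕ} (k : Fin d → ℤ) : Continuous (expMode k) := by
  unfold expMode
  fun_prop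

theorem fourierCoefficient_eq {d : ℕ} (f : (Fin d → ℝ) → ℂ) (k : Fin d → ℤ) :
    fourierCoefficient f k = ∫ x, f x * expMode (-k) x ∂(cubeMeasure d) := by
  simp only [fourierCoefficient, expMode_neg_eq]

theorem expMode_add_two_pi_mul {d : ℕ} (k n : Fin d → ℤ) (x : Fin d → ℝ) :
    expMode k (x + fun j => 2 * π * (n j : ℝ)) = expMode k x := by
  have h : (∑ j, (k j : ℝ) * (x + fun j => 2 * π * (n j : ℝ)) j : ℝ) =
      (∑ j, (k j : ℝ) * x j) + ((∑ j, k j * n j : ℤ) : ℝ) * (2 * π) := by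
    push_cast
    rw [Finset.sum_mul, ← Finset.sum_add_distrib]
    refine Finset.sum_congr rfl fun j _ => ?_
    simp only [Pi.add_apply]
    ring
  rw [expMode, expMode, h, Complex.ofReal_add, mul_add, Complex.exp_add]
  have h2 := Complex.exp_int_mul_two_pi_mul_I (∑ j, k j * n j)
  rw [show Complex.I * ((((∑ j, k j * n j : ℤ) : ℝ) * (2 * π) : ℝ) : ℂ) =
    ((∑ j, k j * n j : ℤ) : ℂ) * (2 * π * Complex.I) by push_cast; ring, h2, mul_one]

/-- The projection of `ℝ^d` onto the torus. -/
def toTorus {d : ℕ} (y : Fin d → ℝ) : UnitAddTorus (Fin d) := fun i => (y i : UnitAddCircle)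

theorem mFourier_toTorus {d : ℕ} (k : Fin d → ℤ) (y : Fin d → ℝ) :
    UnitAddTorus.mFourier k (toTorus y) = expMode k ((2 * π) • y) := by
  rw [UnitAddTorus.mFourier, expMode]
  simp only [ContinuousMap.coe_mk, toTorus, fourier_coe_apply]
  rw [← Complex.exp_sum]
  congr 1
  push_cast
  rw [Finset.mul_sum]
  refine Finset.sum_congr rfl fun j _ => ?_
  simp
  ring

theorem isOpenQuotientMap_toTorus {d : ℕ} : IsOpenQuotientMap (toTorus (d := d)) :=
  IsOpenQuotientMap.piMap fun _ => QuotientAddGroup.isOpenQuotientMap_mk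

/-- A continuous function on `ℝ^d` with period `1` in every variable descends to the torus. -/
theorem exists_torus_lift {d : ℕ} {g : (Fin d → ℝ) → ℂ} (hg : Continuous g)
    (hper : ∀ (y : Fin d → ℝ) (n : Fin d → ℤ), g (y + fun j => (n j : ℝ)) = g y) :
    ∃ F : C(UnitAddTorus (Fin d), ℂ), ∀ y, F (toTorus y) = g y := by
  have hfac : ∀ x y : Fin d → ℝ, toTorus x = toTorus y → g x = g y := by
    intro x y h
    have h1 : ∀ j, ∃ n : ℤ, (n : ℝ) = y j - x j := fun j => by
      have h2 : (x j : UnitAddCircle) = (y j : UnitAddCircle) := congrFun h j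
      rw [QuotientAddGroup.eq] at h2
      obtain ⟨n, hn⟩ := AddSubgroup.mem_zmultiples_iff.1 h2
      refine ⟨n, ?_⟩
      simp only [zsmul_eq_mul, mul_one] at hn
      rw [hn]; ring
    choose n hn using h1
    rw [← hper x n]
    congr 1
    funext j
    simp [hn]
  have hq := (isOpenQuotientMap_toTorus (d := d)).isQuotientMap
  have hsurj := hq.surjective
  let F : UnitAddTorus (Fin d) → ℂ := fun t => g (Function.surjInv hsurj t)
  have hF : ∀ y, F (toTorus y) = g y := fun y => hfac _ _ (Function.surjInv_eq hsurj _)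
  have hcont : Continuous F := by
    rw [hq.continuous_iff]
    exact hg.congr fun y => (hF y).symm
  exact ⟨⟨F, hcont⟩, hF⟩

/-- The half-open unit cell of the integer lattice with lower corner `a`. -/
def unitCell {d : ℕ} (a : Fin d → ℝ) : Set (Fin d → ℝ) := {x | ∀ i, x i ∈ Set.Ioc (a i) (a i + 1)}

theorem mFourierCoeff_eq_integral_unitCell {d : ℕ} (F : UnitAddTorus (Fin d) → ℂ) (k : Fin d → ℤ)
    (a : Fin d → ℝ) : UnitAddTorus.mFourierCoeff F k =
      ∫ y in unitCell a, expMode (-k) ((2 * π) • y) * F (toTorus y) := by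
  simp only [← mFourier_toTorus]
  exact UnitAddTorus.mFourierCoeff_eq_integral F k a

/-- The closed cube agrees up to a null set with the half-open unit cell dilated by `2π`, and the
Jacobian cancels the normalization. This links the measure to integration on the unit torus. -/
theorem integral_cubeMeasure {d : ℕ} {E : Type*} [NormedAddCommGroup E] [NormedSpace ℝ E]
    (h : (Fin d → ℝ) → E) :
    ∫ x, h x ∂(cubeMeasure d) = ∫ y in unitCell (0 : Fin d → ℝ), h ((2 * π) • y) := by
  have hpos : (0 : ℝ) < 2 * π := Real.two_pi_pos
  rw [Measure.setIntegral_comp_smul_of_pos _ _ _ hpos, cubeMeasure, integral_smul_measure]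
  open scoped Pointwise in
  have h1 : (2 * π) • unitCell (0 : Fin d → ℝ) =
      Set.univ.pi fun _ : Fin d => Set.Ioc (0 : ℝ) (2 * π) := by
    ext x
    rw [Set.mem_smul_set_iff_inv_smul_mem₀ hpos.ne']
    simp only [unitCell, Set.mem_ofPred_eq, Set.mem_pi, Set.mem_univ, true_imp_iff, Set.mem_Ioc,
      Pi.smul_apply, smul_eq_mul, Pi.zero_apply, zero_add]
    refine forall_congr' fun i => ?_
    rw [inv_mul_le_iff₀ hpos, mul_one, mul_pos_iff_of_pos_left (inv_pos.2 hpos)]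
  have h2 : (volume.restrict (cube d) : Measure (Fin d → ℝ)) =
      volume.restrict (Set.univ.pi fun _ : Fin d => Set.Ioc (0 : ℝ) (2 * π)) :=
    Measure.restrict_congr_set
      (Measure.univ_pi_Ioc_ae_eq_Icc (μ := fun _ : Fin d => (volume : Measure ℝ))).symm
  rw [h1, ← h2]
  congr 1
  rw [ENNReal.toReal_inv, ENNReal.toReal_ofReal (by positivity)]
  simp

theorem periodic_two_pi_mul {d : ℕ} {f : (Fin d → ℝ) → ℂ}
    (hf : ∀ j : Fin d, Function.Periodic f (Pi.single j (2 * π))) (n : Fin d → ℤ)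
    (x : Fin d → ℝ) : f (x + fun j => 2 * π * (n j : ℝ)) = f x := by
  have h : ∀ s : Finset (Fin d),
      Function.Periodic f (∑ j ∈ s, n j • (Pi.single j (2 * π) : Fin d → ℝ)) := by
    intro s
    induction s using Finset.induction_on with
    | empty => intro x; simp
    | insert a s ha ih =>
      rw [Finset.sum_insert ha]
      exact ((hf a).zsmul (n a)).add_period ih
  have h2 : (fun j => 2 * π * (n j : ℝ)) = ∑ j, n j • (Pi.single j (2 * π) : Fin d → ℝ) := by
    funext i
    rw [Finset.sum_apply, Finset.sum_eq_single i]
    · simp [mul_comm]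
    · intro b _ hb
      simp [Pi.single_eq_of_ne hb.symm]
    · simp
  rw [h2]
  exact h Finset.univ x

theorem exists_torus_lift_two_pi {d : ℕ} {f : (Fin d → ℝ) → ℂ} (hc : Continuous f)
    (hf : ∀ j : Fin d, Function.Periodic f (Pi.single j (2 * π))) :
    ∃ F : C(UnitAddTorus (Fin d), ℂ), ∀ y, F (toTorus y) = f ((2 * π) • y) := by
  refine exists_torus_lift (hc.comp (continuous_const_smul _)) fun y n => ?_
  rw [← periodic_two_pi_mul hf n ((2 * π) • y)]
  congr 1
  funext j
  simp only [Pi.smul_apply, Pi.add_apply, smul_eq_mul, mul_add]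

theorem mFourierCoeff_lift {d : ℕ} {f : (Fin d → ℝ) → ℂ} {F : C(UnitAddTorus (Fin d), ℂ)}
    (hF : ∀ y, F (toTorus y) = f ((2 * π) • y)) (k : Fin d → ℤ) :
    UnitAddTorus.mFourierCoeff F k = fourierCoefficient f k := by
  rw [mFourierCoeff_eq_integral_unitCell F k 0, fourierCoefficient_eq, integral_cubeMeasure]
  simp only [hF, mul_comm]

theorem integral_expMode {d : ℕ} (k : Fin d → ℤ) :
    ∫ x, expMode k x ∂(cubeMeasure d) = if k = 0 then 1 else 0 := by
  have h := orthonormal_iff_ite.1 (UnitAddTorus.orthonormal_mFourier (d := Fin d)) 0 k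
  rw [ContinuousMap.inner_toLp] at h
  simp only [UnitAddTorus.mFourier_zero, ContinuousMap.one_apply, map_one, mul_one] at h
  have h2 := UnitAddTorus.integral_preimage (fun t => UnitAddTorus.mFourier k t) 0
  rw [h] at h2
  rw [integral_cubeMeasure]
  simp only [← mFourier_toTorus, eq_comm (a := k)]
  exact h2.symm

theorem enorm_fourierCoefficient_le {d : ℕ} {r : ℝ} {f : (Fin d → ℝ) → ℂ}
    (hf : f ∈ korobovClass d r) (k : Fin d → ℤ) :
    ENNReal.ofReal ‖fourierCoefficient f k‖ ≤ ∏ j, korobovWeight r (k j) := by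
  simp only [korobovWeight]
  rw [← ENNReal.ofReal_prod_of_nonneg fun j _ => by positivity]
  exact ENNReal.ofReal_le_ofReal (hf.2.2 k)

theorem summable_norm_fourierCoefficient {d : ℕ} {r : ℝ} (hr : 1 < r) {f : (Fin d → ℝ) → ℂ}
    (hf : f ∈ korobovClass d r) : Summable fun k => ‖fourierCoefficient f k‖ := by
  have h : ∑' k, ENNReal.ofReal ‖fourierCoefficient f k‖ ≠ ⊤ :=
    ne_top_of_le_ne_top (tsum_prod_korobovWeight_ne_top hr d)
      (ENNReal.tsum_le_tsum fun k => enorm_fourierCoefficient_le hf k)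
  have := ENNReal.summable_toReal h
  simpa only [ENNReal.toReal_ofReal (norm_nonneg _)] using this

/-- Functions of the Korobov class are sums of their Fourier series. -/
theorem hasSum_fourier_korobovClass {d : ℕ} {r : ℝ} (hr : 1 < r) {f : (Fin d → ℝ) → ℂ}
    (hf : f ∈ korobovClass d r) (x : Fin d → ℝ) :
    HasSum (fun k => fourierCoefficient f k * expMode k x) (f x) := by
  obtain ⟨F, hF⟩ := exists_torus_lift_two_pi hf.1 hf.2.1
  have hs : Summable (UnitAddTorus.mFourierCoeff F) := by
    refine Summable.of_norm ?_
    simp only [mFourierCoeff_lift hF]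
    exact summable_norm_fourierCoefficient hr hf
  have h := UnitAddTorus.hasSum_mFourier_series_apply_of_summable hs (toTorus ((2 * π)⁻¹ • x))
  simp only [mFourierCoeff_lift hF, mFourier_toTorus, hF, smul_eq_mul,
    smul_inv_smul₀ Real.two_pi_pos.ne'] at h
  exact h

/-! ### Poisson summation -/

/-- An integer vector as a real vector. -/
def intVec {d : ℕ} (n : Fin d → ℤ) : Fin d → ℝ := fun j => (n j : ℝ)

/-- This makes the periodization of `g` a finite sum locally, so continuity and the exchange of sum
and integral need no estimates. -/
theorem exists_integer_box_of_hasCompactSupport {d : ℕ} {g : (Fin d → ℝ) → ℂ}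
    (hc : HasCompactSupport g) (M : ℝ) :
    ∃ T : Finset (Fin d → ℤ), ∀ y : Fin d → ℝ, ‖y‖ ≤ M → ∀ n ∉ T, g (y + intVec n) = 0 := by
  obtain ⟨R, hR⟩ := (hc.isCompact.isBounded).exists_norm_le
  refine ⟨Finset.Icc (fun _ => -⌈R + M⌉) (fun _ => ⌈R + M⌉), fun y hy n hn => ?_⟩
  by_contra hne
  apply hn
  have h1 : ‖y + intVec n‖ ≤ R := hR _ (subset_tsupport g hne)
  have h2 : ∀ j, |(n j : ℝ)| ≤ R + M := by
    intro j
    have h3 : intVec n = (y + intVec n) - y := by abel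
    have h4 := norm_le_pi_norm (intVec n) j
    rw [h3] at h4
    have h5 := h4.trans (norm_sub_le _ _)
    simp only [intVec, add_sub_cancel_left, Real.norm_eq_abs] at h5 h1
    exact h5.trans (add_le_add h1 hy)
  rw [Finset.mem_Icc, Pi.le_def, Pi.le_def]
  refine ⟨fun j => ?_, fun j => ?_⟩
  · have h3 := (abs_le.1 (h2 j)).1
    have h4 := Int.le_ceil (R + M)
    have h5 : (-(⌈R + M⌉ : ℝ)) ≤ n j := by linarith
    exact_mod_cast h5
  · have h3 := (abs_le.1 (h2 j)).2
    exact_mod_cast h3.trans (Int.le_ceil (R + M))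

theorem measurableSet_unitCell {d : ℕ} (a : Fin d → ℝ) : MeasurableSet (unitCell a) :=
  MeasurableSet.univ_pi' fun _ => measurableSet_Ioc

theorem norm_le_one_of_mem_unitCell {d : ℕ} {y : Fin d → ℝ} (hy : y ∈ unitCell (0 : Fin d → ℝ)) :
    ‖y‖ ≤ 1 := by
  rw [pi_norm_le_iff_of_nonneg zero_le_one]
  intro j
  have h1 : (0 : ℝ) < y j := (hy j).1
  have h2 : y j ≤ 0 + 1 := (hy j).2
  rw [Real.norm_eq_abs, abs_of_pos h1]
  linarith

theorem add_mem_unitCell_iff {d : ℕ} (y a : Fin d → ℝ) :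
    y + a ∈ unitCell a ↔ y ∈ unitCell (0 : Fin d → ℝ) := by
  refine forall_congr' fun i => ?_
  simp only [Pi.add_apply, Pi.zero_apply, Set.mem_Ioc]
  constructor <;> rintro ⟨h1, h2⟩ <;> constructor <;> linarith

theorem exists_mem_unitCell_intVec {d : ℕ} (y : Fin d → ℝ) :
    ∃ n : Fin d → ℤ, y ∈ unitCell (intVec n) := by
  refine ⟨fun j => ⌈y j⌉ - 1, fun j => ?_⟩
  simp only [intVec, Int.cast_sub, Int.cast_one, Set.mem_Ioc]
  exact ⟨by linarith [Int.ceil_lt_add_one (y j)], by linarith [Int.le_ceil (y j)]⟩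

theorem pairwise_disjoint_unitCell {d : ℕ} :
    Pairwise (Function.onFun Disjoint fun n : Fin d → ℤ => unitCell (intVec n)) := by
  intro n m hnm
  refine Set.disjoint_left.2 fun y hn hm => hnm ?_
  have key : ∀ n : Fin d → ℤ, y ∈ unitCell (intVec n) → ∀ j, ⌈y j⌉ = n j + 1 := by
    intro n hn j
    have h1 : (n j : ℝ) < y j := (hn j).1
    have h2 : y j ≤ n j + 1 := (hn j).2
    rw [Int.ceil_eq_iff]
    push_cast
    constructor <;> linarith
  funext j
  have := (key n hn j).symm.trans (key m hm j)
  omega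

theorem expMode_smul_add_intVec {d : ℕ} (l n : Fin d → ℤ) (y : Fin d → ℝ) :
    expMode l ((2 * π) • (y + intVec n)) = expMode l ((2 * π) • y) := by
  rw [← expMode_add_two_pi_mul l n ((2 * π) • y)]
  congr 1
  funext j
  simp only [Pi.smul_apply, Pi.add_apply, smul_eq_mul, mul_add, intVec]

theorem integral_eq_sum_unitCell {d : ℕ} {G : (Fin d → ℝ) → ℂ} (hG : Integrable G)
    {T : Finset (Fin d → ℤ)}
    (hT : ∀ y ∈ unitCell (0 : Fin d → ℝ), ∀ n ∉ T, G (y + intVec n) = 0) :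
    ∫ y, G y = ∑ n ∈ T, ∫ y in unitCell (0 : Fin d → ℝ), G (y + intVec n) := by
  have h1 : ∀ n : Fin d → ℤ, ∫ y in unitCell (0 : Fin d → ℝ), G (y + intVec n) =
      ∫ y in unitCell (intVec n), G y := by
    intro n
    have h := (measurePreserving_add_right (volume : Measure (Fin d → ℝ))
      (intVec n)).setIntegral_preimage_emb (measurableEmbedding_addRight _) G (unitCell (intVec n))
    rw [← h]
    congr 2
    ext y
    exact (add_mem_unitCell_iff y _).symm
  simp only [h1]
  rw [← integral_biUnion_finset T (fun n _ => measurableSet_unitCell _)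
    (fun n _ m _ hnm => pairwise_disjoint_unitCell hnm) fun n _ => hG.integrableOn]
  refine (setIntegral_eq_integral_of_forall_compl_eq_zero fun y hy => ?_).symm
  obtain ⟨n, hn⟩ := exists_mem_unitCell_intVec y
  have hnT : n ∉ T := fun h => hy (Set.mem_biUnion h hn)
  have h2 := hT (y - intVec n) (by
    rw [← add_mem_unitCell_iff _ (intVec n), sub_add_cancel]; exact hn) n hnT
  rwa [sub_add_cancel] at h2

/-- **Poisson summation** for continuous compactly supported functions on `ℝ^d` with summable
Fourier transform on the integer lattice. -/
theorem tsum_intVec_eq_tsum_fourier {d : ℕ} {g : (Fin d → ℝ) → ℂ} (hg : Continuous g)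
    (hc : HasCompactSupport g)
    (hs : Summable fun l : Fin d → ℤ => ∫ y, g y * expMode (-l) ((2 * π) • y)) :
    ∑' n : Fin d → ℤ, g (intVec n) =
      ∑' l : Fin d → ℤ, ∫ y, g y * expMode (-l) ((2 * π) • y) := by
  set F0 : (Fin d → ℝ) → ℂ := fun y => ∑' n : Fin d → ℤ, g (y + intVec n) with hF0
  have hcont : Continuous F0 := by
    rw [continuous_iff_continuousAt]
    intro a
    obtain ⟨T, hT⟩ := exists_integer_box_of_hasCompactSupport hc (‖a‖ + 1)
    have hfin : ContinuousAt (fun y => ∑ n ∈ T, g (y + intVec n)) a := by fun_prop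
    refine hfin.congr ?_
    filter_upwards [Metric.ball_mem_nhds a one_pos] with y hy
    have hy' : ‖y‖ ≤ ‖a‖ + 1 := by
      have h1 : ‖y - a‖ < 1 := by rwa [mem_ball_iff_norm] at hy
      have h2 := norm_add_le a (y - a)
      rw [add_sub_cancel] at h2
      linarith
    exact (tsum_eq_sum fun n hn => hT y hy' n hn).symm
  have hper : ∀ (y : Fin d → ℝ) (n : Fin d → ℤ), F0 (y + fun j => (n j : ℝ)) = F0 y := by
    intro y n
    rw [hF0]
    refine Eq.trans (tsum_congr fun m => ?_) ((Equiv.addLeft n).tsum_eq fun m => g (y + intVec m))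
    congr 1
    funext j
    simp [intVec, add_assoc]
  obtain ⟨F, hF⟩ := exists_torus_lift hcont hper
  obtain ⟨T, hT⟩ := exists_integer_box_of_hasCompactSupport hc 1
  -- Unfolding: the exponential is invariant under integer translations, so the integral of the
  -- periodization over one cell is an integral of `g` over the whole space.
  have hcoeff : ∀ l, UnitAddTorus.mFourierCoeff F l =
      ∫ y, g y * expMode (-l) ((2 * π) • y) := by
    intro l
    have hGc : Continuous fun y => g y * expMode (-l) ((2 * π) • y) :=
      hg.mul ((continuous_expMode _).comp (continuous_const_smul _))
    have hGi : Integrable fun y => g y * expMode (-l) ((2 * π) • y) :=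
      hGc.integrable_of_hasCompactSupport hc.mul_right
    rw [integral_eq_sum_unitCell hGi (T := T) fun y hy n hn => by
      rw [hT y (norm_le_one_of_mem_unitCell hy) n hn, zero_mul]]
    rw [mFourierCoeff_eq_integral_unitCell F l 0, ← integral_finsetSum]
    · refine setIntegral_congr_fun (measurableSet_unitCell _) fun y hy => ?_
      simp only [hF, hF0, expMode_smul_add_intVec]
      rw [tsum_eq_sum fun n hn => hT y (norm_le_one_of_mem_unitCell hy) n hn, Finset.mul_sum]
      exact Finset.sum_congr rfl fun n _ => mul_comm _ _
    · intro n _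
      exact (hGi.comp_add_right (intVec n)).integrableOn
  have hs' : Summable (UnitAddTorus.mFourierCoeff F) := by
    rwa [show UnitAddTorus.mFourierCoeff F = fun l => ∫ y, g y * expMode (-l) ((2 * π) • y) from
      funext hcoeff]
  -- Poisson's formula is the Fourier series of the periodization evaluated at the origin.
  have h := (UnitAddTorus.hasSum_mFourier_series_apply_of_summable hs' (toTorus 0)).tsum_eq
  rw [hF] at h
  simp only [hcoeff, mFourier_toTorus, smul_zero] at h
  have h0 : ∀ l : Fin d → ℤ, expMode l (0 : Fin d → ℝ) = 1 := fun l => by simp [expMode]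
  simp only [h0, smul_eq_mul, mul_one] at h
  rw [h, hF0]
  simp only [zero_add]

/-! ### The smooth partition of unity and its Fourier transform -/

/-- A smooth function supported in `[-1, 1]` whose integer translates sum to `1`. -/
noncomputable def smoothBump (x : ℝ) : ℝ := smoothTransition (x + 1) - smoothTransition x

theorem contDiff_smoothBump {n : ℕ∞} : ContDiff ℝ n smoothBump :=
  (smoothTransition.contDiff.comp (contDiff_id.add contDiff_const)).sub smoothTransition.contDiff

theorem smoothBump_eq_zero {x : ℝ} (hx : 1 < |x|) : smoothBump x = 0 := by
  rw [smoothBump]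
  rcases lt_abs.1 hx with h | h
  · rw [smoothTransition.one_of_one_le (by linarith), smoothTransition.one_of_one_le (by linarith),
      sub_self]
  · rw [smoothTransition.zero_of_nonpos (by linarith), smoothTransition.zero_of_nonpos (by linarith),
      sub_self]

theorem smoothBump_add_smoothBump_sub_one {x : ℝ} (hx : x ∈ Set.Icc (0 : ℝ) 1) :
    smoothBump (x - 1) + smoothBump x = 1 := by
  rw [smoothBump, smoothBump, sub_add_cancel,
    smoothTransition.one_of_one_le (by linarith [hx.1] : 1 ≤ x + 1),
    smoothTransition.zero_of_nonpos (by linarith [hx.2] : x - 1 ≤ 0)]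
  ring

theorem hasCompactSupport_smoothBump : HasCompactSupport smoothBump := by
  refine HasCompactSupport.intro (K := Set.Icc (-1) 1) isCompact_Icc fun x hx => ?_
  refine smoothBump_eq_zero ?_
  by_contra! h
  exact hx (abs_le.1 h)

/-- The Fourier transform of `smoothBump`. -/
noncomputable def smoothBumpHat (ξ : ℝ) : ℂ :=
  ∫ x : ℝ, (smoothBump x : ℂ) * Complex.exp (Complex.I * ((2 * π * (ξ * x) : ℝ) : ℂ))

theorem integral_exp_int_unitInterval (k : ℤ) :
    ∫ x in (0 : ℝ)..1, Complex.exp (Complex.I * ((2 * π * ((k : ℝ) * x) : ℝ) : ℂ)) =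
      if k = 0 then 1 else 0 := by
  split_ifs with hk
  · subst hk; simp
  · have hc : (2 * π * k * Complex.I : ℂ) ≠ 0 := by
      simp [hk, Real.pi_ne_zero]
    have h := integral_exp_mul_complex (a := 0) (b := 1) hc
    have h1 : Complex.exp (2 * π * k * Complex.I) = 1 := by
      rw [← Complex.exp_int_mul_two_pi_mul_I k]; congr 1; ring
    simp only [Complex.ofReal_one, mul_one, Complex.ofReal_zero, mul_zero, Complex.exp_zero, h1,
      sub_self, zero_div] at h
    rw [← h]
    refine intervalIntegral.integral_congr fun x _ => ?_
    congr 1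
    push_cast
    ring

/-- Folding the integral onto `[0, 1]` replaces the bump by the sum of its translates, which is `1`.
This makes the main term of the lattice rule exact. -/
theorem smoothBumpHat_intCast (k : ℤ) : smoothBumpHat k = if k = 0 then 1 else 0 := by
  set E : ℝ → ℂ := fun x => Complex.exp (Complex.I * ((2 * π * ((k : ℝ) * x) : ℝ) : ℂ)) with hE
  have hEper : ∀ x, E (x - 1) = E x := by
    intro x
    simp only [hE]
    rw [show Complex.I * ((2 * π * ((k : ℝ) * (x - 1)) : ℝ) : ℂ) =
      Complex.I * ((2 * π * ((k : ℝ) * x) : ℝ) : ℂ) - k * (2 * π * Complex.I) by push_cast; ring,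
      Complex.exp_sub, Complex.exp_int_mul_two_pi_mul_I, div_one]
  have hcont : Continuous fun x => (smoothBump x : ℂ) * E x := by
    have h1 : Continuous smoothBump := (contDiff_smoothBump (n := 0)).continuous
    fun_prop
  have h1 : smoothBumpHat k = ∫ x in (-1 : ℝ)..1, (smoothBump x : ℂ) * E x := by
    rw [smoothBumpHat, intervalIntegral.integral_of_le (by norm_num), ← integral_Icc_eq_integral_Ioc]
    refine (setIntegral_eq_integral_of_forall_compl_eq_zero fun x hx => ?_).symm
    rw [smoothBump_eq_zero, Complex.ofReal_zero, zero_mul]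
    by_contra! h
    exact hx (abs_le.1 h)
  have h2 : ∫ x in (-1 : ℝ)..0, (smoothBump x : ℂ) * E x =
      ∫ x in (0 : ℝ)..1, (smoothBump (x - 1) : ℂ) * E x := by
    have h := intervalIntegral.integral_comp_sub_right (a := 0) (b := 1)
      (fun x => (smoothBump x : ℂ) * E x) 1
    norm_num at h
    rw [← h]
    simp only [hEper]
  rw [h1, ← intervalIntegral.integral_add_adjacent_intervals (b := 0)
    (hcont.intervalIntegrable _ _) (hcont.intervalIntegrable _ _), h2,
    ← intervalIntegral.integral_add _ (hcont.intervalIntegrable _ _)]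
  · rw [← integral_exp_int_unitInterval k]
    refine intervalIntegral.integral_congr fun x hx => ?_
    rw [Set.uIcc_of_le zero_le_one] at hx
    rw [← add_mul, ← Complex.ofReal_add, smoothBump_add_smoothBump_sub_one hx, Complex.ofReal_one,
      one_mul]
  · refine Continuous.intervalIntegrable ?_ _ _
    exact (hcont.comp (continuous_sub_right 1)).congr fun x => by
      rw [Function.comp_apply, hEper]

open scoped FourierTransform in
theorem exists_schwartzMap_eq_smoothBumpHat :
    ∃ f : SchwartzMap ℝ ℂ, ∀ ξ, smoothBumpHat ξ = f (-ξ) := by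
  have h1 : HasCompactSupport fun x => (smoothBump x : ℂ) :=
    hasCompactSupport_smoothBump.comp_left Complex.ofReal_zero
  have h2 : ContDiff ℝ (⊤ : ℕ∞) fun x => (smoothBump x : ℂ) :=
    Complex.ofRealCLM.contDiff.comp contDiff_smoothBump
  refine ⟨𝓕 (h1.toSchwartzMap h2), fun ξ => ?_⟩
  rw [SchwartzMap.fourier_coe, Real.fourier_real_eq_integral_exp_smul, smoothBumpHat]
  refine integral_congr_ae (Filter.Eventually.of_forall fun x => ?_)
  simp only [HasCompactSupport.toSchwartzMap_toFun, smul_eq_mul]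
  rw [mul_comm]
  congr 2
  push_cast
  ring

/-- The transform is a Schwartz function. Its sup bound covers `|ξ| ≤ 1`, and decay of an integer
order `N ≥ r` covers the rest. -/
theorem exists_norm_smoothBumpHat_le (r : ℝ) :
    ∃ C : ℝ≥0∞, C ≠ ⊤ ∧ ∀ ξ, ENNReal.ofReal ‖smoothBumpHat ξ‖ ≤ C * korobovWeight r ξ := by
  obtain ⟨f, hf⟩ := exists_schwartzMap_eq_smoothBumpHat
  obtain ⟨N, hN⟩ := exists_nat_ge r
  obtain ⟨C0, hC0⟩ := f.decay 0 0
  obtain ⟨C1, hC1⟩ := f.decay N 0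
  refine ⟨ENNReal.ofReal (C0 + C1), ENNReal.ofReal_ne_top, fun ξ => ?_⟩
  have h0 : ‖smoothBumpHat ξ‖ ≤ C0 := by
    have := hC0.2 (-ξ)
    rw [norm_iteratedFDeriv_zero, pow_zero, one_mul] at this
    rwa [hf]
  have h1 : |ξ| ^ N * ‖smoothBumpHat ξ‖ ≤ C1 := by
    have := hC1.2 (-ξ)
    rw [norm_iteratedFDeriv_zero, norm_neg, Real.norm_eq_abs] at this
    rwa [hf]
  have hmax : (1 : ℝ) ≤ max |ξ| 1 := le_max_right _ _
  rw [korobovWeight, ← ENNReal.ofReal_mul (by linarith [hC0.1, hC1.1])]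
  apply ENNReal.ofReal_le_ofReal
  rw [Real.rpow_neg (by linarith), ← div_eq_mul_inv, le_div_iff₀ (Real.rpow_pos_of_pos (by linarith) _)]
  have h2 : (max |ξ| 1) ^ r ≤ (max |ξ| 1) ^ N := by
    rw [← Real.rpow_natCast]
    exact Real.rpow_le_rpow_of_exponent_le hmax hN
  refine (mul_le_mul_of_nonneg_left h2 (norm_nonneg _)).trans ?_
  rcases le_total |ξ| 1 with h | h
  · rw [max_eq_right h, one_pow, mul_one]; linarith [hC1.1]
  · rw [max_eq_left h, mul_comm]; linarith [hC0.1]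

/-! ### The lattice rule and its error on squared moduli -/

section LatticeRule

variable {d : ℕ}

/-- The lattice `B ℤ^d`, parametrized by integer vectors. -/
noncomputable def latticePoint (B : Matrix (Fin d) (Fin d) ℝ) :
    (Fin d → ℤ) →+ (Fin d → ℝ) where
  toFun l := B.mulVec (intVec l)
  map_zero' := by
    have : intVec (0 : Fin d → ℤ) = 0 := by funext j; simp [intVec]
    rw [this, Matrix.mulVec_zero]
  map_add' l l' := by
    have : intVec (l + l') = intVec l + intVec l' := by funext j; simp [intVec]
    rw [this, Matrix.mulVec_add]

/-- The dual lattice `(Bᵀ)⁻¹ ℤ^d`, which carries the nodes of the quadrature rule. -/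
noncomputable def dualPoint (B : Matrix (Fin d) (Fin d) ℝ) (n : Fin d → ℤ) : Fin d → ℝ :=
  (B.transpose)⁻¹.mulVec (intVec n)

/-- The weight of the node `dualPoint B n` in the lattice rule. -/
noncomputable def nodeWeight (B : Matrix (Fin d) (Fin d) ℝ) (n : Fin d → ℤ) : ℝ :=
  |B.det|⁻¹ * ∏ j, smoothBump (dualPoint B n j)

theorem mulVec_transpose_dualPoint {B : Matrix (Fin d) (Fin d) ℝ} (hB : B.det ≠ 0)
    (n : Fin d → ℤ) : B.transpose.mulVec (dualPoint B n) = intVec n := by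
  rw [dualPoint, Matrix.mulVec_mulVec, Matrix.mul_nonsing_inv, Matrix.one_mulVec]
  rw [Matrix.det_transpose]
  exact isUnit_iff_ne_zero.2 hB

/-- Only dual lattice points coming from an explicit box of integer vectors carry weight. -/
theorem nodeWeight_eq_zero {B : Matrix (Fin d) (Fin d) ℝ} (hB : B.det ≠ 0) {K : ℕ}
    (hK : ∀ i, ∑ j, |B j i| ≤ K) {n : Fin d → ℤ}
    (hn : n ∉ Fintype.piFinset fun _ : Fin d => Finset.Icc (-(K : ℤ)) K) :
    nodeWeight B n = 0 := by
  by_contra hne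
  apply hn
  have hle : ∀ j, |dualPoint B n j| ≤ 1 := by
    intro j
    by_contra! h
    apply hne
    rw [nodeWeight, Finset.prod_eq_zero (Finset.mem_univ j) (smoothBump_eq_zero h), mul_zero]
  rw [Fintype.mem_piFinset]
  intro i
  have h1 : (n i : ℝ) = ∑ j, B j i * dualPoint B n j := by
    have := congrFun (mulVec_transpose_dualPoint hB n) i
    rw [Matrix.mulVec, dotProduct] at this
    simpa [intVec] using this.symm
  have h2 : |(n i : ℝ)| ≤ K := by
    rw [h1]
    refine (Finset.abs_sum_le_sum_abs _ _).trans (le_trans (Finset.sum_le_sum fun j _ => ?_) (hK i))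
    rw [abs_mul]
    exact mul_le_of_le_one_right (abs_nonneg _) (hle j)
  have h3 := abs_le.1 h2
  rw [Finset.mem_Icc]
  exact ⟨by exact_mod_cast h3.1, by exact_mod_cast h3.2⟩

theorem integral_prod_smoothBump_mul_exp (ξ : Fin d → ℝ) :
    ∫ x : Fin d → ℝ, ((∏ j, smoothBump (x j) : ℝ) : ℂ) *
      Complex.exp (Complex.I * ((2 * π * ∑ j, ξ j * x j : ℝ) : ℂ)) = ∏ j, smoothBumpHat (ξ j) := by
  simp only [smoothBumpHat]
  rw [← integral_fintype_prod_volume_eq_prod]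
  refine integral_congr_ae (Filter.Eventually.of_forall fun x => ?_)
  simp only
  rw [Finset.prod_mul_distrib, ← Complex.exp_sum, Complex.ofReal_prod]
  congr 2
  rw [← Finset.mul_sum, Finset.mul_sum]
  push_cast
  rfl

theorem integral_comp_mulVec {M : Matrix (Fin d) (Fin d) ℝ} (hM : M.det ≠ 0)
    {h : (Fin d → ℝ) → ℂ} (hh : Continuous h) :
    ∫ y, h (M.mulVec y) = (|M.det|⁻¹ : ℝ) * ∫ x, h x := by
  have h1 := Real.map_matrix_volume_pi_eq_smul_volume_pi hM
  have hc : Continuous (Matrix.toLin' M) := LinearMap.continuous_of_finiteDimensional _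
  have h2 := integral_map (μ := (volume : Measure (Fin d → ℝ))) hc.measurable.aemeasurable
    (f := h) hh.aestronglyMeasurable
  simp only [Matrix.toLin'_apply] at h2
  rw [← h2, h1, integral_smul_measure, ENNReal.toReal_ofReal (abs_nonneg _), abs_inv,
    Complex.real_smul]

/-- Substitute `y = Bᵀ x`. The pairing of `l` with `y` becomes that of `B l` with `x`, the Jacobian
is `|det B|`, and the integral factors over the coordinates. -/
theorem integral_bump_dual_mode {B : Matrix (Fin d) (Fin d) ℝ} (hB : B.det ≠ 0)
    (k l : Fin d → ℤ) :
    ∫ y : Fin d → ℝ, (((∏ j, smoothBump ((B.transpose)⁻¹.mulVec y j) : ℝ) : ℂ) *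
        expMode k ((2 * π) • (B.transpose)⁻¹.mulVec y)) * expMode (-l) ((2 * π) • y) =
      (|B.det| : ℝ) * ∏ j, smoothBumpHat (k j - latticePoint B l j) := by
  have hu : IsUnit B.transpose.det := by
    rw [Matrix.det_transpose]; exact isUnit_iff_ne_zero.2 hB
  have hdet : ((B.transpose)⁻¹).det ≠ 0 := by
    rw [Matrix.det_nonsing_inv, Ring.inverse_eq_inv', Matrix.det_transpose]
    exact inv_ne_zero hB
  have hc : Continuous smoothBump := (contDiff_smoothBump (n := 0)).continuous
  have hcont : Continuous fun x : Fin d → ℝ => ((∏ j, smoothBump (x j) : ℝ) : ℂ) *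
      Complex.exp (Complex.I * ((2 * π * ∑ j, (k j - latticePoint B l j) * x j : ℝ) : ℂ)) := by
    fun_prop
  rw [← integral_prod_smoothBump_mul_exp]
  have h := integral_comp_mulVec hdet hcont
  rw [Matrix.det_nonsing_inv, Ring.inverse_eq_inv', Matrix.det_transpose, abs_inv, inv_inv] at h
  rw [← h]
  refine integral_congr_ae (Filter.Eventually.of_forall fun y => ?_)
  simp only
  rw [mul_assoc]
  congr 1
  rw [expMode, expMode, ← Complex.exp_add, ← mul_add, ← Complex.ofReal_add]
  congr 3
  have h1 : ∑ j, latticePoint B l j * ((B.transpose)⁻¹.mulVec y) j = ∑ j, (l j : ℝ) * y j := by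
    change (B.mulVec (intVec l)) ⬝ᵥ ((B.transpose)⁻¹.mulVec y) = intVec l ⬝ᵥ y
    rw [← Matrix.vecMul_transpose, ← Matrix.dotProduct_mulVec, Matrix.mulVec_mulVec,
      Matrix.mul_nonsing_inv _ hu, Matrix.one_mulVec]
  simp only [sub_mul, Finset.sum_sub_distrib, h1]
  rw [mul_sub, Finset.mul_sum, Finset.mul_sum, sub_eq_add_neg, ← Finset.sum_neg_distrib]
  congr 1
  · refine Finset.sum_congr rfl fun j _ => ?_
    simp only [Pi.smul_apply, smul_eq_mul]; ring
  · refine Finset.sum_congr rfl fun j _ => ?_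
    simp only [Pi.smul_apply, smul_eq_mul, Pi.neg_apply, Int.cast_neg]; ring

/-- The lattice rule applied to an exponential, by Poisson summation. -/
theorem latticeRule_expMode {B : Matrix (Fin d) (Fin d) ℝ} (hB : B.det ≠ 0) {K : ℕ}
    (hK : ∀ i, ∑ j, |B j i| ≤ K) (k : Fin d → ℤ)
    (hs : Summable fun l => ∏ j, smoothBumpHat (k j - latticePoint B l j)) :
    ∑ n ∈ Fintype.piFinset fun _ : Fin d => Finset.Icc (-(K : ℤ)) K,
        (nodeWeight B n : ℂ) * expMode k ((2 * π) • dualPoint B n) =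
      ∑' l, ∏ j, smoothBumpHat (k j - latticePoint B l j) := by
  have hdet : (|B.det| : ℝ) ≠ 0 := abs_ne_zero.2 hB
  have hdetC : ((|B.det| : ℝ) : ℂ) ≠ 0 := by exact_mod_cast hdet
  have hc : Continuous smoothBump := (contDiff_smoothBump (n := 0)).continuous
  have hmul : Continuous fun y : Fin d → ℝ => (B.transpose)⁻¹.mulVec y :=
    (Matrix.mulVecLin (B.transpose)⁻¹).continuous_of_finiteDimensional
  set g : (Fin d → ℝ) → ℂ := fun y => ((∏ j, smoothBump ((B.transpose)⁻¹.mulVec y j) : ℝ) : ℂ) *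
    expMode k ((2 * π) • (B.transpose)⁻¹.mulVec y) with hg
  have hgc : Continuous g := by
    refine Continuous.mul ?_ ((continuous_expMode k).comp ((continuous_const_smul (2 * π)).comp hmul))
    have : ∀ j, Continuous fun y : Fin d → ℝ => (B.transpose)⁻¹.mulVec y j := fun j =>
      (continuous_apply j).comp hmul
    fun_prop
  have hgs : HasCompactSupport g := by
    have hu : IsUnit B.transpose.det := by
      rw [Matrix.det_transpose]; exact isUnit_iff_ne_zero.2 hB
    have hcomp : IsCompact ((fun x => B.transpose.mulVec x) ''
        Metric.closedBall (0 : Fin d → ℝ) 1) :=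
      (isCompact_closedBall _ _).image
        (Matrix.mulVecLin B.transpose).continuous_of_finiteDimensional
    refine HasCompactSupport.intro hcomp fun y hy => ?_
    have h1 : ¬ ‖(B.transpose)⁻¹.mulVec y‖ ≤ 1 := by
      intro h
      refine hy ⟨(B.transpose)⁻¹.mulVec y, by rwa [mem_closedBall_zero_iff], ?_⟩
      simp only
      rw [Matrix.mulVec_mulVec, Matrix.mul_nonsing_inv _ hu, Matrix.one_mulVec]
    rw [pi_norm_le_iff_of_nonneg zero_le_one] at h1
    push Not at h1
    obtain ⟨j, hj⟩ := h1
    rw [hg]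
    simp only
    rw [Finset.prod_eq_zero (Finset.mem_univ j) (smoothBump_eq_zero hj), Complex.ofReal_zero,
      zero_mul]
  have hint : ∀ l : Fin d → ℤ, ∫ y, g y * expMode (-l) ((2 * π) • y) =
      (|B.det| : ℝ) * ∏ j, smoothBumpHat (k j - latticePoint B l j) := fun l =>
    integral_bump_dual_mode hB k l
  have hP := tsum_intVec_eq_tsum_fourier hgc hgs (by simp only [hint]; exact hs.mul_left _)
  simp only [hint] at hP
  rw [tsum_mul_left] at hP
  have hgn : ∀ n : Fin d → ℤ, (nodeWeight B n : ℂ) * expMode k ((2 * π) • dualPoint B n) =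
      ((|B.det| : ℝ) : ℂ)⁻¹ * g (intVec n) := by
    intro n
    rw [nodeWeight, hg]
    simp only [dualPoint]
    push_cast
    ring
  have hfin := tsum_eq_sum (L := SummationFilter.unconditional _)
    (f := fun n => (nodeWeight B n : ℂ) * expMode k ((2 * π) • dualPoint B n))
    (s := Fintype.piFinset fun _ : Fin d => Finset.Icc (-(K : ℤ)) K)
    fun n hn => by rw [nodeWeight_eq_zero hB hK hn, Complex.ofReal_zero, zero_mul]
  rw [← hfin]
  simp only [hgn]
  rw [tsum_mul_left, hP, inv_mul_cancel_left₀ hdetC]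

/-- The sum of the Korobov weight over the nonzero points of a lattice. -/
noncomputable def latticeMass (r : ℝ) (B : Matrix (Fin d) (Fin d) ℝ) : ℝ≥0∞ :=
  ∑' l : Fin d → ℤ, if l = 0 then 0 else ∏ j, korobovWeight r (latticePoint B l j)

/-- The sum of the Korobov weight over the nonzero points of a lattice shifted by `k`. -/
noncomputable def shiftedLatticeMass (r : ℝ) (B : Matrix (Fin d) (Fin d) ℝ) (k : Fin d → ℤ) :
    ℝ≥0∞ :=
  ∑' l : Fin d → ℤ, if l = 0 then 0 else ∏ j, korobovWeight r (latticePoint B l j - k j)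

/-- After multiplication by the nonzero weight at `k`, each summand is a single term of a
convolution, which is bounded by the weight at the unshifted lattice point. Finiteness supplies the
summability that Poisson summation requires. -/
theorem shiftedLatticeMass_ne_top {r : ℝ} (hr : 1 < r) {B : Matrix (Fin d) (Fin d) ℝ}
    (hmass : latticeMass r B ≠ ⊤) (k : Fin d → ℤ) : shiftedLatticeMass r B k ≠ ⊤ := by
  have hprod : ∏ j, korobovWeight r (k j) ≠ 0 :=
    Finset.prod_ne_zero_iff.2 fun j _ => korobovWeight_ne_zero r _
  have h : shiftedLatticeMass r B k * ∏ j, korobovWeight r (k j) ≤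
      korobovConvConst r ^ d * latticeMass r B := by
    rw [shiftedLatticeMass, latticeMass, ← ENNReal.tsum_mul_right, ← ENNReal.tsum_mul_left]
    refine ENNReal.tsum_le_tsum fun l => ?_
    split_ifs with hl
    · simp
    · exact (ENNReal.le_tsum k).trans (tsum_prod_korobovWeight_conv_le hr (latticePoint B l))
  intro htop
  rw [htop, ENNReal.top_mul hprod, top_le_iff] at h
  exact (ENNReal.mul_ne_top (ENNReal.pow_ne_top (korobovConvConst_ne_top hr)) hmass) h

theorem enorm_latticeRule_expMode_sub_le {r : ℝ} (hr : 1 < r) {B : Matrix (Fin d) (Fin d) ℝ}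
    (hB : B.det ≠ 0) {K : ℕ} (hK : ∀ i, ∑ j, |B j i| ≤ K) (hmass : latticeMass r B ≠ ⊤)
    {Cb : ℝ≥0∞} (hCb : Cb ≠ ⊤)
    (hbump : ∀ ξ, ENNReal.ofReal ‖smoothBumpHat ξ‖ ≤ Cb * korobovWeight r ξ) (k : Fin d → ℤ) :
    ENNReal.ofReal ‖∑ n ∈ Fintype.piFinset fun _ : Fin d => Finset.Icc (-(K : ℤ)) K,
        (nodeWeight B n : ℂ) * expMode k ((2 * π) • dualPoint B n) - if k = 0 then 1 else 0‖ ≤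
      Cb ^ d * shiftedLatticeMass r B k := by
  set p : (Fin d → ℤ) → ℂ := fun l => ∏ j, smoothBumpHat (k j - latticePoint B l j) with hp
  have hpt : ∀ l, ENNReal.ofReal ‖p l‖ ≤
      Cb ^ d * ∏ j, korobovWeight r (latticePoint B l j - k j) := by
    intro l
    rw [hp, norm_prod, ENNReal.ofReal_prod_of_nonneg fun j _ => norm_nonneg _]
    refine (Finset.prod_le_prod' fun j _ => hbump _).trans_eq ?_
    rw [Finset.prod_mul_distrib, Finset.prod_const, Finset.card_univ, Fintype.card_fin]
    congr 1
    refine Finset.prod_congr rfl fun j _ => ?_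
    rw [← korobovWeight_neg, neg_sub]
  -- The term `l = 0` is the exact integral of the exponential, so only nonzero `l` contribute to
  -- the error.
  have hp0 : p 0 = if k = 0 then 1 else 0 := by
    rw [hp]
    simp only [map_zero, Pi.zero_apply, sub_zero, smoothBumpHat_intCast]
    by_cases hk : k = 0
    · subst hk; simp
    · rw [if_neg hk]
      obtain ⟨j, hj⟩ := Function.ne_iff.1 hk
      exact Finset.prod_eq_zero (Finset.mem_univ j) (if_neg hj)
  have hle : ∑' l, ENNReal.ofReal ‖if l = 0 then 0 else p l‖ ≤
      Cb ^ d * shiftedLatticeMass r B k := by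
    rw [shiftedLatticeMass, ← ENNReal.tsum_mul_left]
    refine ENNReal.tsum_le_tsum fun l => ?_
    split_ifs with hl
    · simp
    · exact hpt l
  have hfin : ∑' l, ENNReal.ofReal ‖if l = 0 then 0 else p l‖ ≠ ⊤ :=
    ne_top_of_le_ne_top (ENNReal.mul_ne_top (ENNReal.pow_ne_top hCb)
      (shiftedLatticeMass_ne_top hr hmass k)) hle
  have hs' : Summable fun l => if l = 0 then 0 else p l := by
    refine Summable.of_norm ?_
    simpa only [ENNReal.toReal_ofReal (norm_nonneg _)] using ENNReal.summable_toReal hfin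
  have hsingle : HasSum (fun l : Fin d → ℤ => if l = 0 then p l else 0) (p 0) := by
    have := hasSum_single (f := fun l : Fin d → ℤ => if l = 0 then p l else 0) 0
      fun l hl => if_neg hl
    simpa using this
  have hsum : HasSum p (p 0 + ∑' l, if l = 0 then 0 else p l) := by
    refine (hsingle.add hs'.hasSum).congr_fun fun l => ?_
    split_ifs <;> simp
  rw [latticeRule_expMode hB hK k hsum.summable, hsum.tsum_eq, ← hp0, add_sub_cancel_left]
  refine le_trans ?_ hle
  simp only [ofReal_norm]
  exact enorm_tsum_le_tsum_enorm

theorem hasSum_norm_sq_korobovClass {r : ℝ} (hr : 1 < r) {f : (Fin d → ℝ) → ℂ}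
    (hf : f ∈ korobovClass d r) (x : Fin d → ℝ) :
    HasSum (fun q : (Fin d → ℤ) × (Fin d → ℤ) => fourierCoefficient f q.1 *
      starRingEnd ℂ (fourierCoefficient f q.2) * expMode (q.1 - q.2) x) ((‖f x‖ ^ 2 : ℝ) : ℂ) := by
  have h1 := hasSum_fourier_korobovClass hr hf x
  have hn : Summable fun k => ‖fourierCoefficient f k * expMode k x‖ := by
    simpa only [norm_mul, norm_expMode, mul_one] using summable_norm_fourierCoefficient hr hf
  have h2 := Complex.hasSum_conj'.2 h1
  have hn' : Summable fun k => ‖starRingEnd ℂ (fourierCoefficient f k * expMode k x)‖ := by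
    simpa only [RCLike.norm_conj] using hn
  have hmul := summable_mul_of_summable_norm hn hn'
  have h3 := h1.mul h2 hmul
  have h4 : ((‖f x‖ ^ 2 : ℝ) : ℂ) = f x * starRingEnd ℂ (f x) := by
    rw [Complex.mul_conj, Complex.normSq_eq_norm_sq]
  rw [h4]
  refine h3.congr_fun fun q => ?_
  rw [← expMode_mul_conj, map_mul]
  ring

theorem summable_norm_fourier_mul {r : ℝ} (hr : 1 < r) {f : (Fin d → ℝ) → ℂ}
    (hf : f ∈ korobovClass d r) :
    Summable fun q : (Fin d → ℤ) × (Fin d → ℤ) => ‖fourierCoefficient f q.1 *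
      starRingEnd ℂ (fourierCoefficient f q.2)‖ := by
  have hn := summable_norm_fourierCoefficient hr hf
  have h := Summable.mul_norm (f := fourierCoefficient f)
    (g := fun k => starRingEnd ℂ (fourierCoefficient f k)) hn
    (by simpa only [RCLike.norm_conj] using hn)
  exact h

theorem hasSum_integral_norm_sq_korobovClass {r : ℝ} (hr : 1 < r) {f : (Fin d → ℝ) → ℂ}
    (hf : f ∈ korobovClass d r) :
    HasSum (fun q : (Fin d → ℤ) × (Fin d → ℤ) => fourierCoefficient f q.1 *
      starRingEnd ℂ (fourierCoefficient f q.2) * if q.1 - q.2 = 0 then 1 else 0)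
      ((∫ x, ‖f x‖ ^ 2 ∂(cubeMeasure d) : ℝ) : ℂ) := by
  have := isProbabilityMeasure_cubeMeasure d
  have hint : ∀ k : Fin d → ℤ, Integrable (expMode k) (cubeMeasure d) := fun k =>
    Integrable.of_bound (continuous_expMode k).aestronglyMeasurable 1
      (Filter.Eventually.of_forall fun x => (norm_expMode k x).le)
  have h := hasSum_integral_of_summable_integral_norm (μ := cubeMeasure d)
    (F := fun (q : (Fin d → ℤ) × (Fin d → ℤ)) x => fourierCoefficient f q.1 *
      starRingEnd ℂ (fourierCoefficient f q.2) * expMode (q.1 - q.2) x)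
    (fun q => (hint _).const_mul _) (by
      simp only [norm_mul, norm_expMode, mul_one, integral_const, probReal_univ, one_smul]
      simpa only [norm_mul] using summable_norm_fourier_mul hr hf)
  simp only [(hasSum_norm_sq_korobovClass hr hf _).tsum_eq, integral_const_mul,
    integral_expMode] at h
  rwa [integral_complex_ofReal] at h

/-- The error of the lattice rule for `‖f‖²` on the Korobov class is controlled by the mass of the
nonzero lattice points. -/
theorem latticeRule_norm_sq_error_le {r : ℝ} (hr : 1 < r) {B : Matrix (Fin d) (Fin d) ℝ}
    (hB : B.det ≠ 0) {K : ℕ} (hK : ∀ i, ∑ j, |B j i| ≤ K) (hmass : latticeMass r B ≠ ⊤)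
    {Cb : ℝ≥0∞} (hCb : Cb ≠ ⊤)
    (hbump : ∀ ξ, ENNReal.ofReal ‖smoothBumpHat ξ‖ ≤ Cb * korobovWeight r ξ)
    {f : (Fin d → ℝ) → ℂ} (hf : f ∈ korobovClass d r) :
    ENNReal.ofReal |(∫ x, ‖f x‖ ^ 2 ∂(cubeMeasure d)) -
        ∑ n ∈ Fintype.piFinset fun _ : Fin d => Finset.Icc (-(K : ℤ)) K,
          nodeWeight B n * ‖f ((2 * π) • dualPoint B n)‖ ^ 2| ≤
      Cb ^ d * (korobovConvConst r ^ d * korobovConvConst r ^ d) * latticeMass r B := by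
  set T := Fintype.piFinset fun _ : Fin d => Finset.Icc (-(K : ℤ)) K with hT
  set e : (Fin d → ℤ) → ℂ := fun k => ∑ n ∈ T, (nodeWeight B n : ℂ) *
    expMode k ((2 * π) • dualPoint B n) - if k = 0 then 1 else 0 with he
  set a := fourierCoefficient f with ha
  have h1 : HasSum (fun q : (Fin d → ℤ) × (Fin d → ℤ) => a q.1 * starRingEnd ℂ (a q.2) *
      e (q.1 - q.2)) (((∑ n ∈ T, nodeWeight B n * ‖f ((2 * π) • dualPoint B n)‖ ^ 2) -
        (∫ x, ‖f x‖ ^ 2 ∂(cubeMeasure d)) : ℝ) : ℂ) := by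
    have h2 : HasSum (fun q : (Fin d → ℤ) × (Fin d → ℤ) => ∑ n ∈ T, (nodeWeight B n : ℂ) *
        (a q.1 * starRingEnd ℂ (a q.2) * expMode (q.1 - q.2) ((2 * π) • dualPoint B n)))
        (∑ n ∈ T, (nodeWeight B n : ℂ) * ((‖f ((2 * π) • dualPoint B n)‖ ^ 2 : ℝ) : ℂ)) :=
      hasSum_sum fun n _ => (hasSum_norm_sq_korobovClass hr hf _).mul_left _
    have h3 := h2.sub (hasSum_integral_norm_sq_korobovClass hr hf)
    have h4 : (((∑ n ∈ T, nodeWeight B n * ‖f ((2 * π) • dualPoint B n)‖ ^ 2) -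
        (∫ x, ‖f x‖ ^ 2 ∂(cubeMeasure d)) : ℝ) : ℂ) =
        ∑ n ∈ T, (nodeWeight B n : ℂ) * ((‖f ((2 * π) • dualPoint B n)‖ ^ 2 : ℝ) : ℂ) -
        ((∫ x, ‖f x‖ ^ 2 ∂(cubeMeasure d) : ℝ) : ℂ) := by
      rw [Complex.ofReal_sub, Complex.ofReal_sum]
      simp only [Complex.ofReal_mul]
    rw [h4]
    refine h3.congr_fun fun q => ?_
    rw [he]
    simp only
    rw [mul_sub, Finset.mul_sum]
    congr 1
    refine Finset.sum_congr rfl fun n _ => ?_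
    ring
  have h5 : ENNReal.ofReal |(∫ x, ‖f x‖ ^ 2 ∂(cubeMeasure d)) -
      ∑ n ∈ T, nodeWeight B n * ‖f ((2 * π) • dualPoint B n)‖ ^ 2| ≤
      ∑' q : (Fin d → ℤ) × (Fin d → ℤ),
        ENNReal.ofReal ‖a q.1 * starRingEnd ℂ (a q.2) * e (q.1 - q.2)‖ := by
    rw [abs_sub_comm, ← Real.norm_eq_abs, ← Complex.norm_real, ← h1.tsum_eq]
    simp only [ofReal_norm]
    exact enorm_tsum_le_tsum_enorm
  refine h5.trans ?_
  have he' : ∀ k, ENNReal.ofReal ‖e k‖ ≤ Cb ^ d * shiftedLatticeMass r B k := fun k =>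
    enorm_latticeRule_expMode_sub_le hr hB hK hmass hCb hbump k
  set P : (Fin d → ℤ) → ℝ≥0∞ := fun k => ∏ j, korobovWeight r (k j) with hP
  have ha' : ∀ k, ENNReal.ofReal ‖a k‖ ≤ P k := fun k => enorm_fourierCoefficient_le hf k
  calc ∑' q : (Fin d → ℤ) × (Fin d → ℤ),
        ENNReal.ofReal ‖a q.1 * starRingEnd ℂ (a q.2) * e (q.1 - q.2)‖
      ≤ ∑' q : (Fin d → ℤ) × (Fin d → ℤ),
          P q.1 * P q.2 * (Cb ^ d * shiftedLatticeMass r B (q.1 - q.2)) := by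
        refine ENNReal.tsum_le_tsum fun q => ?_
        rw [norm_mul, norm_mul, RCLike.norm_conj, ENNReal.ofReal_mul (by positivity),
          ENNReal.ofReal_mul (by positivity)]
        exact mul_le_mul' (mul_le_mul' (ha' _) (ha' _)) (he' _)
    -- All terms are nonnegative, so the order of summation is free. The sum over `l` goes outermost
    -- and the sum over `k` innermost, so that the inner sums become convolutions.
    _ = Cb ^ d * ∑' l : Fin d → ℤ, if l = 0 then 0 else
          ∑' m : Fin d → ℤ, P m * ∑' k : Fin d → ℤ,
            (∏ j, korobovWeight r ((latticePoint B l j + m j) - k j)) * P k := by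
        rw [← ENNReal.tsum_mul_left, ENNReal.tsum_prod', ENNReal.tsum_comm]
        have h6 : ∀ (m k : Fin d → ℤ), P k * P m * (Cb ^ d * shiftedLatticeMass r B (k - m)) =
            ∑' l : Fin d → ℤ, Cb ^ d * if l = 0 then 0 else P m *
              ((∏ j, korobovWeight r ((latticePoint B l j + m j) - k j)) * P k) := by
          intro m k
          rw [shiftedLatticeMass, ENNReal.tsum_mul_left, mul_left_comm, ← ENNReal.tsum_mul_left]
          congr 1
          refine tsum_congr fun l => ?_
          split_ifs
          · simp
          · simp only [Pi.sub_apply, Int.cast_sub, sub_sub_eq_add_sub]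
            ring
        simp only [h6]
        have h7 : ∀ m : Fin d → ℤ, ∑' k : Fin d → ℤ, ∑' l : Fin d → ℤ,
            Cb ^ d * (if l = 0 then 0 else P m *
              ((∏ j, korobovWeight r ((latticePoint B l j + m j) - k j)) * P k)) =
            ∑' l : Fin d → ℤ, Cb ^ d * if l = 0 then 0 else P m * ∑' k : Fin d → ℤ,
              ((∏ j, korobovWeight r ((latticePoint B l j + m j) - k j)) * P k) := by
          intro m
          rw [ENNReal.tsum_comm]
          refine tsum_congr fun l => ?_
          split_ifs
          · simp
          · rw [ENNReal.tsum_mul_left, ENNReal.tsum_mul_left]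
        simp only [h7]
        rw [ENNReal.tsum_comm]
        refine tsum_congr fun l => ?_
        split_ifs
        · simp
        · rw [ENNReal.tsum_mul_left]
    -- Summing over `k` gives the weight at `Bl + m`. The reflection `m ↦ -m`, under which the
    -- weight is even, turns the sum over `m` into a second convolution, giving the weight at `Bl`.
    _ ≤ Cb ^ d * ∑' l : Fin d → ℤ, (korobovConvConst r ^ d * korobovConvConst r ^ d) *
          if l = 0 then 0 else ∏ j, korobovWeight r (latticePoint B l j) := by
        gcongr with l
        split_ifs with hl
        · simp
        · calc ∑' m : Fin d → ℤ, P m * ∑' k : Fin d → ℤ,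
                (∏ j, korobovWeight r ((latticePoint B l j + m j) - k j)) * P k
              ≤ ∑' m : Fin d → ℤ, P m * (korobovConvConst r ^ d *
                  ∏ j, korobovWeight r (latticePoint B l j + m j)) := by
                gcongr with m
                exact tsum_prod_korobovWeight_conv_le hr fun j => latticePoint B l j + m j
            _ = korobovConvConst r ^ d * ∑' m : Fin d → ℤ,
                  (∏ j, korobovWeight r (latticePoint B l j - m j)) * P m := by
                rw [← ENNReal.tsum_mul_left, ← (Equiv.neg (Fin d → ℤ)).tsum_eq]
                refine tsum_congr fun m => ?_
                have : P (-m) = P m := by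
                  simp only [hP, Pi.neg_apply, Int.cast_neg, korobovWeight_neg]
                simp only [Equiv.neg_apply, this, Pi.neg_apply, Int.cast_neg, ← sub_eq_add_neg]
                ring
            _ ≤ _ := by
                rw [mul_assoc]
                gcongr
                exact tsum_prod_korobovWeight_conv_le hr (latticePoint B l)
    _ = _ := by
        rw [ENNReal.tsum_mul_left, latticeMass]; ring

end LatticeRule

/-! ### Assembling the upper bound -/

/-- A rule with fewer than `m` nodes is padded to exactly `m` knots by repeating `x₀` with weight
`0`. -/
theorem optimalDiscretizationError_le_of_rule {X ι : Type*} [MeasurableSpace X] {Ω : Set X}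
    {μ : Measure X} {W : Set (X → ℂ)} {m : ℕ} (T : Finset ι) (hT : T.card ≤ m)
    (a : ι → Ω) (x₀ : Ω) (b : ι → ℝ) {E : ℝ≥0∞}
    (h : ∀ f ∈ W, ENNReal.ofReal |(∫ x, ‖f x‖ ^ 2 ∂μ) - ∑ n ∈ T, b n * ‖f (a n)‖ ^ 2| ≤ E) :
    optimalDiscretizationError Ω μ 2 W m ≤ E := by
  obtain ⟨e⟩ : Nonempty (T ↪ Fin m) := by
    apply Function.Embedding.nonempty_of_card_le
    simpa using hT
  refine iInf_le_of_le (Function.extend e (fun n => a n) fun _ => x₀)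
    (iInf_le_of_le (Function.extend e (fun n => b n) 0) (iSup₂_le fun f hf => ?_))
  have hsum : ∑ n ∈ T, b n * ‖f (a n)‖ ^ 2 =
      ∑ j, Function.extend e (fun n : T => b n) 0 j *
        ‖f (Function.extend e (fun n : T => a n) (fun _ => x₀) j : Ω)‖ ^ 2 := by
    rw [← Finset.sum_coe_sort]
    refine Fintype.sum_of_injective e e.injective _ _ (fun j hj => ?_) fun n => ?_
    · rw [Function.extend_apply' _ _ _ hj, Pi.zero_apply, zero_mul]
    · rw [e.injective.extend_apply, e.injective.extend_apply]
  simp only [Real.rpow_two]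
  rw [← hsum]
  exact h f hf

theorem fract_mem_cube {d : ℕ} (y : Fin d → ℝ) :
    ((2 * π) • fun j => Int.fract (y j)) ∈ cube d := by
  have hpi := Real.two_pi_pos
  refine ⟨fun j => ?_, fun j => ?_⟩
  · exact mul_nonneg hpi.le (Int.fract_nonneg _)
  · exact mul_le_of_le_one_right hpi.le (Int.fract_lt_one _).le

theorem periodic_apply_fract {d : ℕ} {f : (Fin d → ℝ) → ℂ}
    (hf : ∀ j : Fin d, Function.Periodic f (Pi.single j (2 * π))) (y : Fin d → ℝ) :
    f ((2 * π) • fun j => Int.fract (y j)) = f ((2 * π) • y) := by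
  rw [← periodic_two_pi_mul hf (fun j => ⌊y j⌋)]
  congr 1
  funext j
  simp only [Pi.add_apply, Pi.smul_apply, smul_eq_mul]
  rw [← mul_add, Int.fract_add_floor]

theorem exists_optimalDiscretizationError_le_pow {d : ℕ} (hd : 1 ≤ d) {r : ℝ} (hr : 1 < r) :
    ∃ (C : ℝ≥0∞) (M : ℕ), C ≠ ⊤ ∧ 1 ≤ M ∧ ∀ n m : ℕ, M * 2 ^ n ≤ m →
      optimalDiscretizationError (cube d) (cubeMeasure d) 2 (korobovClass d r) m ≤
        C * (ENNReal.ofReal (2 ^ (-r)) ^ n * ((n + 1 : ℕ) : ℝ≥0∞) ^ (d - 1)) := by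
  obtain ⟨B, hB, hBprod⟩ := exists_matrix_one_le_prod_abs hd
  obtain ⟨Cb, hCb, hbump⟩ := exists_norm_smoothBumpHat_le r
  obtain ⟨C, hC, hmass⟩ := exists_tsum_lattice_korobovWeight_le hd hr
  obtain ⟨K₀, hK₀⟩ : ∃ K₀ : ℕ, ∀ i, ∑ j, |B j i| ≤ K₀ := by
    refine ⟨⌈∑ i, ∑ j, |B j i|⌉₊, fun i => le_trans ?_ (Nat.le_ceil _)⟩
    exact Finset.single_le_sum (f := fun i => ∑ j, |B j i|)
      (fun i _ => Finset.sum_nonneg fun j _ => abs_nonneg _) (Finset.mem_univ i)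
  refine ⟨Cb ^ d * (korobovConvConst r ^ d * korobovConvConst r ^ d) * C, (5 * (K₀ + 1)) ^ d, ?_,
    Nat.one_le_pow _ _ (by omega), fun n m hm => ?_⟩
  · have := korobovConvConst_ne_top hr
    finiteness
  -- The dilation is chosen so that `a^d = 2^n`. It multiplies the coordinate products of lattice
  -- points, and the order of the number of nodes, by `2^n`.
  set a : ℝ := (2 : ℝ) ^ ((n : ℝ) / d) with ha
  have ha1 : 1 ≤ a := Real.one_le_rpow one_le_two (by positivity)
  have had : a ^ d = 2 ^ n := by
    rw [ha, ← Real.rpow_natCast, ← Real.rpow_mul (by norm_num), div_mul_cancel₀, Real.rpow_natCast]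
    exact_mod_cast (by omega : d ≠ 0)
  have ha0 : 0 < a := by linarith
  have hB' : (a • B).det ≠ 0 := by
    rw [Matrix.det_smul]
    exact mul_ne_zero (pow_ne_zero _ ha0.ne') hB
  have hpt : ∀ l j, latticePoint (a • B) l j = a * (B.mulVec fun i => (l i : ℝ)) j := by
    intro l j
    change ((a • B).mulVec (intVec l)) j = _
    rw [Matrix.smul_mulVec]
    rfl
  have hprod : ∀ l : Fin d → ℤ, l ≠ 0 → (2 : ℝ) ^ n ≤ ∏ j, |latticePoint (a • B) l j| := by
    intro l hl
    simp only [hpt, abs_mul, abs_of_pos ha0]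
    rw [Finset.prod_mul_distrib, Finset.prod_const, Finset.card_univ, Fintype.card_fin, had]
    exact le_mul_of_one_le_right (by positivity) (hBprod l hl)
  -- The `+ 1` makes the argument at least `1`, so the ceiling at most doubles it and `2K + 1 ≤
  -- 5a(K₀ + 1)`.
  set K : ℕ := ⌈a * (K₀ + 1)⌉₊ with hKdef
  have hK : ∀ i, ∑ j, |(a • B) j i| ≤ K := by
    intro i
    refine le_trans ?_ (Nat.le_ceil _)
    simp only [Matrix.smul_apply, smul_eq_mul, abs_mul, abs_of_pos ha0]
    rw [← Finset.mul_sum]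
    have := hK₀ i
    gcongr
    linarith
  have hle := hmass n (latticePoint (a • B)) hprod
  have hmass' : latticeMass r (a • B) ≠ ⊤ := by
    refine ne_top_of_le_ne_top ?_ hle
    finiteness
  have hcard : (Fintype.piFinset fun _ : Fin d => Finset.Icc (-(K : ℤ)) K).card ≤ m := by
    refine le_trans ?_ hm
    rw [Fintype.card_piFinset]
    simp only [Int.card_Icc, Finset.prod_const, Finset.card_univ, Fintype.card_fin]
    have h1 : ((K : ℤ) + 1 - -(K : ℤ)).toNat = 2 * K + 1 := by omega
    rw [h1]
    have h2 : (K : ℝ) ≤ 2 * (a * (K₀ + 1)) := by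
      have h3 : 1 ≤ a * ((K₀ : ℝ) + 1) := by
        have : (0 : ℝ) ≤ K₀ := by positivity
        nlinarith
      have := Nat.ceil_lt_add_one (a := a * ((K₀ : ℝ) + 1)) (by linarith)
      linarith
    have h4 : ((2 * K + 1 : ℕ) : ℝ) ≤ a * (5 * (K₀ + 1)) := by
      push_cast
      have : (0 : ℝ) ≤ K₀ := by positivity
      nlinarith
    have h5 := pow_le_pow_left₀ (by positivity) h4 d
    rw [mul_pow, had, mul_comm (2 ^ n : ℝ)] at h5
    exact_mod_cast h5
  -- The dual points may lie outside the cube; periodicity allows them to be replaced by their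
  -- fractional parts.
  refine optimalDiscretizationError_le_of_rule _ hcard
    (fun n => ⟨_, fract_mem_cube (dualPoint (a • B) n)⟩) ⟨_, fract_mem_cube 0⟩
    (nodeWeight (a • B)) fun f hf => ?_
  simp only [periodic_apply_fract hf.2.1]
  refine (latticeRule_norm_sq_error_le hr hB' hK hmass' hCb hbump hf).trans ?_
  rw [mul_assoc _ C]
  gcongr
  exact hle

/-- With all weights zero the error is the squared norm, and functions of the class are uniformly
bounded by the sum of the weights. This serves the finitely many `m` too small for the lattice rule.
-/
theorem exists_optimalDiscretizationError_le {d : ℕ} {r : ℝ} (hr : 1 < r) :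
    ∃ D : ℝ≥0∞, D ≠ ⊤ ∧ ∀ m : ℕ,
      optimalDiscretizationError (cube d) (cubeMeasure d) 2 (korobovClass d r) m ≤ D := by
  have hfin := tsum_prod_korobovWeight_ne_top hr d
  set D : ℝ≥0∞ := ∑' k : Fin d → ℤ, ∏ j, korobovWeight r (k j) with hD
  have := isProbabilityMeasure_cubeMeasure d
  refine ⟨ENNReal.ofReal (D.toReal ^ 2), ENNReal.ofReal_ne_top, fun m => ?_⟩
  refine optimalDiscretizationError_le_of_rule (∅ : Finset ℕ) (Nat.zero_le _)
    (fun _ => ⟨_, fract_mem_cube 0⟩) ⟨_, fract_mem_cube 0⟩ (fun _ => 0) fun f hf => ?_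
  rw [Finset.sum_empty, sub_zero]
  apply ENNReal.ofReal_le_ofReal
  have hbound : ∀ x, ‖f x‖ ≤ D.toReal := by
    intro x
    rw [← ENNReal.ofReal_le_iff_le_toReal hfin, ← (hasSum_fourier_korobovClass hr hf x).tsum_eq,
      ofReal_norm]
    refine enorm_tsum_le_tsum_enorm.trans (ENNReal.tsum_le_tsum fun k => ?_)
    rw [← ofReal_norm, norm_mul, norm_expMode, mul_one]
    exact enorm_fourierCoefficient_le hf k
  rw [← Real.norm_eq_abs]
  refine (norm_integral_le_of_norm_le_const (C := D.toReal ^ 2)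
    (Filter.Eventually.of_forall fun x => ?_)).trans_eq (by simp)
  rw [norm_pow, norm_norm]
  exact pow_le_pow_left₀ (norm_nonneg _) (hbound x) 2

/-- The upper bound for the optimal discretization error on the Korobov class. -/
theorem exists_optimalDiscretizationError_le_rpow_mul_log {d : ℕ} (hd : 1 ≤ d) {r : ℝ}
    (hr : 1 < r) :
    ∃ C : ℝ, 0 < C ∧ ∀ m : ℕ, 2 ≤ m →
      optimalDiscretizationError (cube d) (cubeMeasure d) 2 (korobovClass d r) m ≤
        ENNReal.ofReal (C * ((m : ℝ) ^ (-r) * Real.log m ^ (d - 1))) := by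
  obtain ⟨C₁, M, hC₁, hM, h₁⟩ := exists_optimalDiscretizationError_le_pow hd hr
  obtain ⟨D, hD, h₂⟩ := exists_optimalDiscretizationError_le (d := d) hr
  have hlog2 : 0 < Real.log 2 := Real.log_pos one_lt_two
  have hM0 : (0 : ℝ) < M := by exact_mod_cast hM
  set A : ℝ := (2 * M) ^ r * (2 / Real.log 2) ^ (d - 1) with hA
  -- `A` serves `m ≥ M`, where `m ≤ 2M·2^n` and `n + 1 ≤ (2 / log 2) log m`. `A'` makes the target
  -- at least `1` when `2 ≤ m < M`, where the trivial bound is used.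
  set A' : ℝ := (M : ℝ) ^ r * (1 / Real.log 2) ^ (d - 1) with hA'
  have hA0 : 0 < A := by positivity
  have hA0' : 0 < A' := by positivity
  refine ⟨C₁.toReal * A + D.toReal * A' + 1, by positivity, fun m hm => ?_⟩
  have hm0 : (0 : ℝ) < m := by positivity
  have hlogm : Real.log 2 ≤ Real.log m := Real.log_le_log two_pos (by exact_mod_cast hm)
  have hlogm0 : 0 < Real.log m := by linarith
  have hR0 : 0 < (m : ℝ) ^ (-r) * Real.log m ^ (d - 1) := by positivity
  rcases le_or_gt M m with hMm | hMm
  · set n := Nat.log 2 (m / M) with hn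
    have hdiv : m / M ≠ 0 := (Nat.div_pos hMm hM).ne'
    have hn1 : M * 2 ^ n ≤ m := by
      have h3 := Nat.pow_log_le_self 2 hdiv
      exact (Nat.mul_le_mul_left M h3).trans (Nat.mul_div_le m M)
    have hn2 : (m : ℝ) ≤ 2 * M * 2 ^ n := by
      have h3 : m / M < 2 ^ (n + 1) := Nat.lt_pow_succ_log_self one_lt_two _
      have h4 : m < 2 ^ (n + 1) * M := (Nat.div_lt_iff_lt_mul hM).1 h3
      have h5 : (m : ℝ) ≤ 2 ^ (n + 1) * M := by exact_mod_cast h4.le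
      rw [pow_succ] at h5
      linarith
    refine (h₁ n m hn1).trans ?_
    have hpow : ((2 : ℝ) ^ (-r)) ^ n ≤ (2 * M) ^ r * (m : ℝ) ^ (-r) := by
      have h3 : ((2 : ℝ) ^ (-r)) ^ n = ((2 : ℝ) ^ n) ^ (-r) := by
        rw [← Real.rpow_natCast, ← Real.rpow_natCast, ← Real.rpow_mul (by norm_num),
          ← Real.rpow_mul (by norm_num), mul_comm]
      have h4 := Real.rpow_le_rpow_of_nonpos hm0 hn2 (by linarith : -r ≤ 0)
      rw [Real.mul_rpow (by positivity) (by positivity)] at h4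
      calc ((2 : ℝ) ^ (-r)) ^ n = (2 * M) ^ r * ((2 * M) ^ (-r) * ((2 : ℝ) ^ n) ^ (-r)) := by
            rw [h3, ← mul_assoc, ← Real.rpow_add (by positivity), add_neg_cancel, Real.rpow_zero,
              one_mul]
        _ ≤ _ := by gcongr
    have hlogn : ((n + 1 : ℕ) : ℝ) ≤ 2 / Real.log 2 * Real.log m := by
      have h3 : (2 : ℝ) ^ n ≤ m := by
        have h5 : 2 ^ n ≤ m := (Nat.le_mul_of_pos_left _ hM).trans hn1
        exact_mod_cast h5
      have h4 : n * Real.log 2 ≤ Real.log m := by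
        rw [← Real.log_pow]
        exact Real.log_le_log (by positivity) h3
      rw [div_mul_eq_mul_div, le_div_iff₀ hlog2]
      push_cast
      linarith
    have hlogn' := pow_le_pow_left₀ (by positivity) hlogn (d - 1)
    rw [mul_pow] at hlogn'
    have hreal : C₁.toReal * (((2 : ℝ) ^ (-r)) ^ n * ((n + 1 : ℕ) : ℝ) ^ (d - 1)) ≤
        (C₁.toReal * A + D.toReal * A' + 1) * ((m : ℝ) ^ (-r) * Real.log m ^ (d - 1)) := by
      calc C₁.toReal * (((2 : ℝ) ^ (-r)) ^ n * ((n + 1 : ℕ) : ℝ) ^ (d - 1))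
          ≤ C₁.toReal * (((2 * M) ^ r * (m : ℝ) ^ (-r)) *
              ((2 / Real.log 2) ^ (d - 1) * Real.log m ^ (d - 1))) := by gcongr
        _ = C₁.toReal * A * ((m : ℝ) ^ (-r) * Real.log m ^ (d - 1)) := by rw [hA]; ring
        _ ≤ _ := by
            gcongr
            have : 0 ≤ D.toReal * A' := by positivity
            linarith
    refine le_trans (le_of_eq ?_) (ENNReal.ofReal_le_ofReal hreal)
    rw [ENNReal.ofReal_mul ENNReal.toReal_nonneg, ENNReal.ofReal_toReal hC₁,
      ENNReal.ofReal_mul (by positivity), ENNReal.ofReal_pow (by positivity),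
      ENNReal.ofReal_pow (by positivity), ENNReal.ofReal_natCast]
  · refine (h₂ m).trans ?_
    rw [← ENNReal.ofReal_toReal hD]
    apply ENNReal.ofReal_le_ofReal
    have h3 : 1 ≤ A' * ((m : ℝ) ^ (-r) * Real.log m ^ (d - 1)) := by
      have h4 : 1 ≤ (M : ℝ) ^ r * (m : ℝ) ^ (-r) := by
        rw [Real.rpow_neg hm0.le, ← div_eq_mul_inv, one_le_div (by positivity)]
        exact Real.rpow_le_rpow hm0.le (by exact_mod_cast hMm.le) (by linarith)
      have h5 : 1 ≤ (1 / Real.log 2) ^ (d - 1) * Real.log m ^ (d - 1) := by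
        rw [← mul_pow]
        refine one_le_pow₀ ?_
        rw [one_div_mul_eq_div, one_le_div hlog2]
        exact hlogm
      calc (1 : ℝ) ≤ ((M : ℝ) ^ r * (m : ℝ) ^ (-r)) *
            ((1 / Real.log 2) ^ (d - 1) * Real.log m ^ (d - 1)) := one_le_mul_of_one_le_of_one_le h4 h5
        _ = _ := by rw [hA']; ring
    rw [ENNReal.ofReal_toReal hD]
    have h6 : D.toReal ≤ D.toReal * (A' * ((m : ℝ) ^ (-r) * Real.log m ^ (d - 1))) :=
      le_mul_of_one_le_right ENNReal.toReal_nonneg h3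
    have h7 : 0 ≤ C₁.toReal * A := by positivity
    nlinarith

/-! ### The lower bound by fooling functions -/

section LowerBound

variable {d : ℕ}

theorem integrable_cubeMeasure {E : Type*} [NormedAddCommGroup E] {f : (Fin d → ℝ) → E}
    (hf : Continuous f) : Integrable f (cubeMeasure d) := by
  refine Integrable.smul_measure hf.integrableOn_Icc ?_
  rw [ENNReal.inv_ne_top, Ne, ENNReal.ofReal_eq_zero, not_le]
  positivity

theorem periodic_expMode (k : Fin d → ℤ) (j : Fin d) :
    Function.Periodic (expMode k) (Pi.single j (2 * π)) := by
  intro x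
  rw [← expMode_add_two_pi_mul k (Pi.single j 1) x]
  congr 2
  funext i
  by_cases hi : i = j
  · subst hi; simp
  · simp [hi]

/-- There is a nontrivial trigonometric polynomial vanishing at fewer points than frequencies. -/
theorem exists_trigPoly_vanishing (F : Finset (Fin d → ℤ)) {m : ℕ} (hm : m < F.card)
    (x : Fin m → Fin d → ℝ) :
    ∃ a : (Fin d → ℤ) → ℂ, (∑ k ∈ F, ‖a k‖ ^ 2 = 1) ∧
      ∀ i, ∑ k ∈ F, a k * expMode k (x i) = 0 := by
  let L : (F → ℂ) →ₗ[ℂ] (Fin m → ℂ) :=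
    { toFun := fun b i => ∑ k : F, b k * expMode (k : Fin d → ℤ) (x i)
      map_add' := fun b b' => by
        funext i
        simp only [Pi.add_apply, add_mul, Finset.sum_add_distrib]
      map_smul' := fun c b => by
        funext i
        simp only [Pi.smul_apply, smul_eq_mul, RingHom.id_apply, Finset.mul_sum, mul_assoc] }
  have hker : LinearMap.ker L ≠ ⊥ := by
    apply LinearMap.ker_ne_bot_of_finrank_lt
    simpa using hm
  obtain ⟨b, hb, hb0⟩ := (Submodule.ne_bot_iff _).1 hker
  have hLb : ∀ i, ∑ k : F, b k * expMode (k : Fin d → ℤ) (x i) = 0 := fun i =>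
    congrFun (LinearMap.mem_ker.1 hb) i
  set N : ℝ := ∑ k : F, ‖b k‖ ^ 2 with hN
  have hN0 : 0 < N := by
    obtain ⟨k, hk⟩ := Function.ne_iff.1 hb0
    refine Finset.sum_pos' (fun k _ => by positivity) ⟨k, Finset.mem_univ k, ?_⟩
    have : 0 < ‖b k‖ := norm_pos_iff.2 hk
    positivity
  classical
  refine ⟨fun k => if h : k ∈ F then ((Real.sqrt N)⁻¹ : ℝ) * b ⟨k, h⟩ else 0, ?_, fun i => ?_⟩
  · rw [← Finset.sum_coe_sort]
    simp only [Finset.coe_mem, dif_pos, norm_mul, mul_pow, Complex.norm_real, norm_inv,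
      Real.norm_eq_abs, inv_pow, sq_abs, Real.sq_sqrt hN0.le]
    rw [← Finset.mul_sum, ← hN, inv_mul_cancel₀ hN0.ne']
  · rw [← Finset.sum_coe_sort]
    simp only [Finset.coe_mem, dif_pos, mul_assoc]
    rw [← Finset.mul_sum, hLb, mul_zero]

theorem norm_sq_trigPoly (F : Finset (Fin d → ℤ)) (a : (Fin d → ℤ) → ℂ) (x : Fin d → ℝ) :
    ((‖∑ k ∈ F, a k * expMode k x‖ ^ 2 : ℝ) : ℂ) =
      ∑ k ∈ F, ∑ l ∈ F, a k * starRingEnd ℂ (a l) * expMode (k - l) x := by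
  rw [← Complex.normSq_eq_norm_sq, ← Complex.mul_conj, map_sum, Finset.sum_mul_sum]
  refine Finset.sum_congr rfl fun k _ => Finset.sum_congr rfl fun l _ => ?_
  rw [← expMode_mul_conj, map_mul]
  ring

theorem fourierCoefficient_norm_sq_trigPoly (F : Finset (Fin d → ℤ)) (a : (Fin d → ℤ) → ℂ)
    (q : Fin d → ℤ) :
    fourierCoefficient (fun x => ((‖∑ k ∈ F, a k * expMode k x‖ ^ 2 : ℝ) : ℂ)) q =
      ∑ k ∈ F, ∑ l ∈ F, a k * starRingEnd ℂ (a l) * if k - l = q then 1 else 0 := by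
  rw [fourierCoefficient_eq]
  simp only [norm_sq_trigPoly, Finset.sum_mul, mul_assoc, ← expMode_add]
  rw [integral_finsetSum]
  · refine Finset.sum_congr rfl fun k _ => ?_
    rw [integral_finsetSum]
    · refine Finset.sum_congr rfl fun l _ => ?_
      rw [integral_const_mul, integral_const_mul, integral_expMode]
      simp only [← sub_eq_add_neg, sub_eq_zero]
    · intro l _
      exact ((integrable_cubeMeasure (continuous_expMode _)).const_mul _).const_mul _
  · intro k _
    exact integrable_finsetSum _ fun l _ =>
      ((integrable_cubeMeasure (continuous_expMode _)).const_mul _).const_mul _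

/-- Nonnegativity lets the mean alone control every coefficient, so nothing needs to be known about
the polynomial produced by the dimension count. -/
theorem norm_fourierCoefficient_le_of_nonneg {h : (Fin d → ℝ) → ℝ} (h0 : ∀ x, 0 ≤ h x)
    (q : Fin d → ℤ) :
    ‖fourierCoefficient (fun x => (h x : ℂ)) q‖ ≤ ∫ x, h x ∂(cubeMeasure d) := by
  rw [fourierCoefficient_eq]
  refine (norm_integral_le_integral_norm _).trans_eq ?_
  simp only [norm_mul, norm_expMode, mul_one, Complex.norm_real, Real.norm_of_nonneg (h0 _)]

/-- A nonnegative trigonometric polynomial of dyadic degree `2^s` with mean `1` that vanishes at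
fewer than `2^{|s|}` prescribed points. -/
theorem exists_nonneg_trigPoly_vanishing (s : Fin d → ℕ) {m : ℕ} (hm : m < 2 ^ ∑ j, s j)
    (x : Fin m → Fin d → ℝ) :
    ∃ h : (Fin d → ℝ) → ℝ, Continuous h ∧
      (∀ j : Fin d, Function.Periodic h (Pi.single j (2 * π))) ∧ (∀ y, 0 ≤ h y) ∧
      (∀ i, h (x i) = 0) ∧ (∫ y, h y ∂(cubeMeasure d) = 1) ∧
      ∀ q : Fin d → ℤ, (∃ j, 2 ^ s j ≤ (q j).natAbs) →
        fourierCoefficient (fun y => (h y : ℂ)) q = 0 := by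
  set F : Finset (Fin d → ℤ) := Fintype.piFinset fun j => Finset.Ico 0 (2 ^ s j) with hF
  have hcard : F.card = 2 ^ ∑ j, s j := by
    rw [hF, Fintype.card_piFinset, ← Finset.prod_pow_eq_pow_sum]
    refine Finset.prod_congr rfl fun j _ => ?_
    rw [Int.card_Ico, sub_zero]
    exact Int.toNat_natCast (2 ^ s j)
  obtain ⟨a, ha1, ha0⟩ := exists_trigPoly_vanishing F (by rwa [hcard]) x
  refine ⟨fun y => ‖∑ k ∈ F, a k * expMode k y‖ ^ 2, ?_, fun j y => ?_, fun y => by positivity,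
    fun i => ?_, ?_, fun q hq => ?_⟩
  · have := fun k : Fin d → ℤ => continuous_expMode k
    fun_prop
  · simp only [periodic_expMode _ j y]
  · change ‖∑ k ∈ F, a k * expMode k (x i)‖ ^ 2 = 0
    rw [ha0 i]; simp
  · have h := fourierCoefficient_norm_sq_trigPoly F a 0
    rw [fourierCoefficient_eq] at h
    simp only [neg_zero, expMode_zero, mul_one] at h
    rw [integral_complex_ofReal] at h
    have h2 : ∑ k ∈ F, ∑ l ∈ F, a k * starRingEnd ℂ (a l) * (if k - l = 0 then 1 else 0) =
        ((∑ k ∈ F, ‖a k‖ ^ 2 : ℝ) : ℂ) := by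
      rw [Complex.ofReal_sum]
      refine Finset.sum_congr rfl fun k hk => ?_
      simp only [sub_eq_zero, mul_ite, mul_one, mul_zero]
      rw [Finset.sum_ite_eq, if_pos hk, Complex.mul_conj, Complex.normSq_eq_norm_sq]
    rw [h2, ha1] at h
    exact_mod_cast h
  · obtain ⟨j, hj⟩ := hq
    rw [fourierCoefficient_norm_sq_trigPoly]
    refine Finset.sum_eq_zero fun k hk => Finset.sum_eq_zero fun l hl => ?_
    rw [if_neg, mul_zero]
    intro hkl
    have hk' := Finset.mem_Ico.1 (Fintype.mem_piFinset.1 hk j)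
    have hl' := Finset.mem_Ico.1 (Fintype.mem_piFinset.1 hl j)
    have hj' : ((2 ^ s j : ℕ) : ℤ) ≤ ((q j).natAbs : ℤ) := by exact_mod_cast hj
    push_cast at hj'
    rw [← hkl, Pi.sub_apply] at hj'
    have := abs_lt.2 (⟨by omega, by omega⟩ : -(2 ^ s j : ℤ) < k j - l j ∧ k j - l j < 2 ^ s j)
    omega

/-- All coordinates but the first range freely up to `⌊n/d⌋`, and the first takes up the remainder.
-/
theorem le_card_piAntidiag (hd : 1 ≤ d) (n : ℕ) :
    ((n : ℝ) / d) ^ (d - 1) ≤ ((Finset.piAntidiag (Finset.univ : Finset (Fin d)) n).card : ℝ) := by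
  obtain ⟨e, rfl⟩ : ∃ e, d = e + 1 := ⟨d - 1, by omega⟩
  have hcard : (n / (e + 1) + 1) ^ e ≤
      (Finset.piAntidiag (Finset.univ : Finset (Fin (e + 1))) n).card := by
    have hT : (Fintype.piFinset fun _ : Fin e => Finset.range (n / (e + 1) + 1)).card =
        (n / (e + 1) + 1) ^ e := by
      rw [Fintype.card_piFinset]; simp
    rw [← hT]
    refine Finset.card_le_card_of_injOn (fun t => Fin.cons (n - ∑ i, t i) t) ?_ ?_
    · intro t ht
      have ht' : ∀ i, t i ≤ n / (e + 1) := fun i => by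
        have := Finset.mem_range.1 (Fintype.mem_piFinset.1 ht i)
        omega
      have hsum : ∑ i, t i ≤ n := by
        refine (Finset.sum_le_sum fun i _ => ht' i).trans ?_
        rw [Finset.sum_const, Finset.card_univ, Fintype.card_fin, smul_eq_mul]
        calc e * (n / (e + 1)) ≤ (e + 1) * (n / (e + 1)) := Nat.mul_le_mul_right _ (by omega)
          _ ≤ n := Nat.mul_div_le n (e + 1)
      rw [Finset.mem_coe, Finset.mem_piAntidiag]
      refine ⟨?_, fun i _ => Finset.mem_univ i⟩
      rw [Fin.sum_univ_succ]
      simp only [Fin.cons_zero, Fin.cons_succ]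
      omega
    · intro t _ t' _ h
      exact (Fin.cons_injective2 h).2
  rw [Nat.add_sub_cancel]
  have h1 : (n : ℝ) / ((e + 1 : ℕ) : ℝ) ≤ ((n / (e + 1) + 1 : ℕ) : ℝ) := by
    rw [div_le_iff₀ (by positivity)]
    have h2 : n < (n / (e + 1) + 1) * (e + 1) := by
      have := Nat.lt_div_mul_add (a := n) (b := e + 1) (by omega)
      linarith
    exact_mod_cast h2.le
  exact (pow_le_pow_left₀ (by positivity) h1 e).trans (by exact_mod_cast hcard)

/-- Subtracting `κ` leaves vectors with sum `u = n - ∑ κ_j`. The count depends only on this excess,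
not on `n`. -/
theorem card_filter_piAntidiag_le (hd : 1 ≤ d) (κ : Fin d → ℕ) (n : ℕ)
    (h : ((Finset.piAntidiag Finset.univ n).filter fun s : Fin d → ℕ => ∀ j, κ j ≤ s j).Nonempty) :
    ∃ u, n = ∑ j, κ j + u ∧
      ((Finset.piAntidiag Finset.univ n).filter fun s : Fin d → ℕ => ∀ j, κ j ≤ s j).card ≤
        (u + 1) ^ (d - 1) := by
  obtain ⟨s₀, hs₀⟩ := h
  simp only [Finset.mem_filter, Finset.mem_piAntidiag] at hs₀
  have hle : ∑ j, κ j ≤ n := by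
    rw [← hs₀.1.1]
    exact Finset.sum_le_sum fun j _ => hs₀.2 j
  obtain ⟨u, hu⟩ := Nat.exists_eq_add_of_le hle
  refine ⟨u, hu, ?_⟩
  have hcard := card_sum_eq_le hd u
  have hmaps : Set.MapsTo (fun (s : Fin d → ℕ) j => s j - κ j)
      (((Finset.piAntidiag Finset.univ n).filter fun s : Fin d → ℕ => ∀ j, κ j ≤ s j) :
        Set (Fin d → ℕ)) {s : Fin d → ℕ | ∑ j, s j = u} := by
    intro s hs
    rw [Finset.mem_coe, Finset.mem_filter, Finset.mem_piAntidiag] at hs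
    change ∑ j, (s j - κ j) = u
    rw [Finset.sum_tsub_distrib _ fun j _ => hs.2 j, hs.1.1]
    omega
  have hinj : Set.InjOn (fun (s : Fin d → ℕ) j => s j - κ j)
      (((Finset.piAntidiag Finset.univ n).filter fun s : Fin d → ℕ => ∀ j, κ j ≤ s j) :
        Set (Fin d → ℕ)) := by
    intro s hs s' hs' heq
    rw [Finset.mem_coe, Finset.mem_filter] at hs hs'
    funext j
    have h1 := congrFun heq j
    have h2 := hs.2 j
    have h3 := hs'.2 j
    simp only at h1
    omega
  have := (Set.encard_le_encard_of_injOn hmaps hinj).trans hcard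
  rw [Set.encard_coe_eq_coe_finsetCard] at this
  exact_mod_cast this

theorem exists_succ_pow_le_two_rpow (D : ℕ) {r : ℝ} (hr : 1 < r) :
    ∃ M : ℝ, 0 < M ∧ ∀ u : ℕ, ((u + 1 : ℕ) : ℝ) ^ D ≤ M * 2 ^ (r * u) := by
  have hs := summable_pow_mul_geometric_of_norm_lt_one (R := ℝ) D (r := 1 / 2) (by norm_num)
  have hnn : ∀ u : ℕ, (0 : ℝ) ≤ (u : ℝ) ^ D * (1 / 2) ^ u := fun u => by positivity
  have hS0 : 0 ≤ ∑' u : ℕ, (u : ℝ) ^ D * (1 / 2) ^ u := tsum_nonneg hnn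
  refine ⟨2 * (∑' u : ℕ, (u : ℝ) ^ D * (1 / 2) ^ u) + 1, by positivity, fun u => ?_⟩
  have h1 := hs.le_tsum (u + 1) fun v _ => hnn v
  have h2 : (2 : ℝ) ^ u ≤ 2 ^ (r * u) := by
    rw [← Real.rpow_natCast]
    refine Real.rpow_le_rpow_of_exponent_le one_le_two ?_
    have : (0 : ℝ) ≤ u := by positivity
    nlinarith
  set S := ∑' u : ℕ, (u : ℝ) ^ D * (1 / 2) ^ u with hS
  have h3 : ((u + 1 : ℕ) : ℝ) ^ D ≤ 2 * S * 2 ^ u := by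
    have h4 : ((u + 1 : ℕ) : ℝ) ^ D = 2 * (((u + 1 : ℕ) : ℝ) ^ D * (1 / 2) ^ (u + 1)) * 2 ^ u := by
      rw [pow_succ, one_div_pow]
      field_simp
    rw [h4]
    gcongr
  calc ((u + 1 : ℕ) : ℝ) ^ D ≤ 2 * S * 2 ^ u := h3
    _ ≤ (2 * S + 1) * 2 ^ (r * u) := by gcongr; linarith

/-- A nonnegative function of (a multiple of) the Korobov class that vanishes at `m < 2^n` points
and has mean of order `2^{-rn} n^{d-1}`. -/
theorem exists_fooling_function (hd : 1 ≤ d) {r : ℝ} (hr : 1 < r) :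
    ∃ c : ℝ, 0 < c ∧ ∀ (n m : ℕ), m < 2 ^ n → ∀ x : Fin m → Fin d → ℝ,
      ∃ g : (Fin d → ℝ) → ℝ, Continuous g ∧
        (∀ j : Fin d, Function.Periodic g (Pi.single j (2 * π))) ∧ (∀ y, 0 ≤ g y) ∧
        (∀ i, g (x i) = 0) ∧
        (∀ k : Fin d → ℤ, ‖fourierCoefficient (fun y => (g y : ℂ)) k‖ ≤
          ∏ j, (max |(k j : ℝ)| 1) ^ (-r)) ∧
        c * (((2 : ℝ) ^ n) ^ (-r) * (n : ℝ) ^ (d - 1)) ≤ ∫ y, g y ∂(cubeMeasure d) := by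
  obtain ⟨M, hM0, hM⟩ := exists_succ_pow_le_two_rpow (d - 1) hr
  refine ⟨M⁻¹ * ((d : ℝ)⁻¹) ^ (d - 1), by
    have : (0 : ℝ) < d := by exact_mod_cast hd
    positivity, fun n m hm x => ?_⟩
  set S := Finset.piAntidiag (Finset.univ : Finset (Fin d)) n with hS
  have hex : ∀ s : S, m < 2 ^ ∑ j, (s : Fin d → ℕ) j := fun s => by
    rw [(Finset.mem_piAntidiag.1 s.2).1]; exact hm
  choose h hcont hper hnn hzero hint hcoeff using fun s : S =>
    exists_nonneg_trigPoly_vanishing (s : Fin d → ℕ) (hex s) x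
  -- At a frequency of dyadic size `2^κ` at most `M 2^(ru)` summands are active, where `u = n - ∑
  -- κ_j`. This factor leaves exactly `2^(-r ∑ κ_j)`, which the class allows.
  set A : ℝ := M⁻¹ * ((2 : ℝ) ^ n) ^ (-r) with hA
  have hA0 : 0 < A := by positivity
  refine ⟨fun y => A * ∑ s, h s y, by fun_prop, fun j y => ?_, fun y => ?_, fun i => ?_, fun k => ?_,
    ?_⟩
  · simp only [hper _ j y]
  · exact mul_nonneg hA0.le (Finset.sum_nonneg fun s _ => hnn s y)
  · simp only [hzero, Finset.sum_const_zero, mul_zero]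
  · have h1 : fourierCoefficient (fun y => ((A * ∑ s, h s y : ℝ) : ℂ)) k =
        A * ∑ s, fourierCoefficient (fun y => (h s y : ℂ)) k := by
      simp only [fourierCoefficient_eq]
      rw [← integral_finsetSum, ← integral_const_mul]
      · refine integral_congr_ae (Filter.Eventually.of_forall fun y => ?_)
        simp only
        push_cast
        rw [mul_assoc, Finset.sum_mul]
      · intro s _
        exact integrable_cubeMeasure
          ((Complex.continuous_ofReal.comp (hcont s)).mul (continuous_expMode _))
    -- With binary length, `|k_j| < 2^(κ_j)` holds, and `κ_j ≤ s_j` is equivalent to `|k_j| <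
    -- 2^(s_j)`. Summands violating this for some `j` have no coefficient at `k`.
    set κ : Fin d → ℕ := fun j => Nat.size (k j).natAbs with hκ
    have h2 : ‖∑ s : S, fourierCoefficient (fun y => (h s y : ℂ)) k‖ ≤
        ((S.filter fun s => ∀ j, κ j ≤ s j).card : ℝ) := by
      have h3 : ∀ s : S, ‖fourierCoefficient (fun y => (h s y : ℂ)) k‖ ≤
          if ∀ j, κ j ≤ (s : Fin d → ℕ) j then 1 else 0 := by
        intro s
        split_ifs with hs
        · exact (norm_fourierCoefficient_le_of_nonneg (hnn s) k).trans_eq (hint s)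
        · push Not at hs
          obtain ⟨j, hj⟩ := hs
          rw [hcoeff s k ⟨j, Nat.lt_size.1 hj⟩, norm_zero]
      refine (norm_sum_le _ _).trans ((Finset.sum_le_sum fun s _ => h3 s).trans_eq ?_)
      rw [Finset.sum_coe_sort S (fun s => if ∀ j, κ j ≤ s j then (1 : ℝ) else 0),
        Finset.sum_boole]
    rw [h1, norm_mul, Complex.norm_real, Real.norm_of_nonneg hA0.le]
    refine (mul_le_mul_of_nonneg_left h2 hA0.le).trans ?_
    rcases (S.filter fun s => ∀ j, κ j ≤ s j).eq_empty_or_nonempty with hemp | hne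
    · rw [hemp, Finset.card_empty, Nat.cast_zero, mul_zero]
      exact Finset.prod_nonneg fun j _ => by positivity
    · obtain ⟨u, hu, hcard⟩ := card_filter_piAntidiag_le hd κ n hne
      have h4 : ((S.filter fun s => ∀ j, κ j ≤ s j).card : ℝ) ≤ M * 2 ^ (r * u) :=
        le_trans (by exact_mod_cast hcard) (hM u)
      calc A * ((S.filter fun s => ∀ j, κ j ≤ s j).card : ℝ) ≤ A * (M * 2 ^ (r * u)) := by gcongr
        _ = ((2 : ℝ) ^ (∑ j, κ j)) ^ (-r) := by
            rw [hA, hu, pow_add, Real.mul_rpow (by positivity) (by positivity),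
              ← Real.rpow_natCast 2 u, ← Real.rpow_mul (by norm_num), mul_comm (u : ℝ) (-r),
              neg_mul, Real.rpow_neg (by norm_num) (r * u)]
            have : (0 : ℝ) < 2 ^ (r * u) := by positivity
            field_simp
        _ = ∏ j, ((2 : ℝ) ^ κ j) ^ (-r) := by
            rw [← Finset.prod_pow_eq_pow_sum, Real.finsetProd_rpow _ _ fun j _ => by positivity]
        _ ≤ _ := by
            refine Finset.prod_le_prod (fun j _ => by positivity) fun j _ => ?_
            refine Real.rpow_le_rpow_of_nonpos (lt_max_of_lt_right one_pos) ?_ (by linarith)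
            refine max_le ?_ (one_le_pow₀ one_le_two)
            have h5 : (k j).natAbs < 2 ^ κ j := Nat.lt_size_self _
            rw [← Int.cast_abs, Int.abs_eq_natAbs]
            exact_mod_cast h5.le
  · rw [integral_const_mul, integral_finsetSum _ fun s _ => integrable_cubeMeasure (hcont s)]
    simp only [hint, Finset.sum_const, Finset.card_univ, Fintype.card_coe, nsmul_eq_mul, mul_one]
    have h1 := le_card_piAntidiag hd n
    rw [← hS, div_eq_mul_inv, mul_pow] at h1
    calc M⁻¹ * ((d : ℝ)⁻¹) ^ (d - 1) * (((2 : ℝ) ^ n) ^ (-r) * (n : ℝ) ^ (d - 1))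
        = A * ((n : ℝ) ^ (d - 1) * ((d : ℝ)⁻¹) ^ (d - 1)) := by rw [hA]; ring
      _ ≤ A * S.card := by gcongr

/-- Adding half of a fooling function to the constant `1/2` stays in the real Korobov class. -/
theorem half_one_add_mem_realKorobovClass {r : ℝ} {g : (Fin d → ℝ) → ℝ} (hg : Continuous g)
    (hper : ∀ j : Fin d, Function.Periodic g (Pi.single j (2 * π)))
    (hcoeff : ∀ k : Fin d → ℤ, ‖fourierCoefficient (fun y => (g y : ℂ)) k‖ ≤
      ∏ j, (max |(k j : ℝ)| 1) ^ (-r)) :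
    (fun y => (((1 + g y) / 2 : ℝ) : ℂ)) ∈ realKorobovClass d r := by
  refine ⟨⟨by fun_prop, fun j y => ?_, fun k => ?_⟩, fun y => Complex.ofReal_im _⟩
  · simp only [hper j y]
  · have h1 : fourierCoefficient (fun y => (((1 + g y) / 2 : ℝ) : ℂ)) k =
        1 / 2 * ((if k = 0 then 1 else 0) + fourierCoefficient (fun y => (g y : ℂ)) k) := by
      rw [fourierCoefficient_eq, fourierCoefficient_eq]
      have h2 := integral_expMode (-k)
      simp only [neg_eq_zero] at h2
      rw [← h2, ← integral_add, ← integral_const_mul]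
      · refine integral_congr_ae (Filter.Eventually.of_forall fun y => ?_)
        simp only
        push_cast
        ring
      · exact integrable_cubeMeasure (continuous_expMode _)
      · exact integrable_cubeMeasure
          ((Complex.continuous_ofReal.comp hg).mul (continuous_expMode _))
    have h3 : ‖(if k = 0 then (1 : ℂ) else 0)‖ ≤ ∏ j, (max |(k j : ℝ)| 1) ^ (-r) := by
      split_ifs with hk
      · subst hk; simp
      · rw [norm_zero]; exact Finset.prod_nonneg fun j _ => by positivity
    rw [h1, norm_mul]
    have h4 := norm_add_le (if k = 0 then (1 : ℂ) else 0) (fourierCoefficient (fun y => (g y : ℂ)) k)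
    have h5 := hcoeff k
    have h6 : ‖(1 / 2 : ℂ)‖ = 1 / 2 := by norm_num
    rw [h6]
    linarith

/-- A fooling function bounds the optimal error for the real Korobov class from below. -/
theorem ofReal_le_optimalDiscretizationError {r : ℝ} {m : ℕ} {b : ℝ}
    (h : ∀ x : Fin m → Fin d → ℝ, ∃ g : (Fin d → ℝ) → ℝ, Continuous g ∧
        (∀ j : Fin d, Function.Periodic g (Pi.single j (2 * π))) ∧ (∀ y, 0 ≤ g y) ∧
        (∀ i, g (x i) = 0) ∧
        (∀ k : Fin d → ℤ, ‖fourierCoefficient (fun y => (g y : ℂ)) k‖ ≤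
          ∏ j, (max |(k j : ℝ)| 1) ^ (-r)) ∧
        b ≤ ∫ y, g y ∂(cubeMeasure d)) :
    ENNReal.ofReal (b / 4) ≤
      optimalDiscretizationError (cube d) (cubeMeasure d) 2 (realKorobovClass d r) m := by
  have := isProbabilityMeasure_cubeMeasure d
  refine le_iInf fun ξ => le_iInf fun w => ?_
  obtain ⟨g, hg, hper, hnn, hzero, hcoeff, hb⟩ := h fun i => ξ i
  have hmem1 := half_one_add_mem_realKorobovClass hg hper hcoeff
  have hmem0 := half_one_add_mem_realKorobovClass (d := d) (r := r) (g := fun _ => 0)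
    continuous_const (fun j y => rfl) (fun k => by
      rw [fourierCoefficient_eq]
      simp only [Complex.ofReal_zero, zero_mul, integral_zero, norm_zero]
      exact Finset.prod_nonneg fun j _ => by positivity)
  set E : ((Fin d → ℝ) → ℂ) → ℝ := fun f =>
    (∫ x, ‖f x‖ ^ (2 : ℝ) ∂(cubeMeasure d)) - ∑ j, w j * ‖f (ξ j)‖ ^ (2 : ℝ) with hE
  -- The knot sums cancel because `g` vanishes there, and `((1+g)/2)² - (1/2)² = g/2 + g²/4 ≥ g/2`.
  -- The constant `1/2` is what makes the gap linear in `g`.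
  have hdiff : b / 2 ≤ E (fun y => (((1 + g y) / 2 : ℝ) : ℂ)) -
      E (fun _ => (((1 + 0) / 2 : ℝ) : ℂ)) := by
    have hi1 : Integrable (fun y => ((1 + g y) / 2) ^ 2) (cubeMeasure d) :=
      integrable_cubeMeasure (by fun_prop)
    have hi2 : Integrable (fun _ : Fin d → ℝ => ((1 + 0 : ℝ) / 2) ^ 2) (cubeMeasure d) :=
      integrable_cubeMeasure continuous_const
    simp only [hE, Real.rpow_two, Complex.norm_real, Real.norm_eq_abs, sq_abs, hzero]
    rw [sub_sub_sub_cancel_right, ← integral_sub hi1 hi2]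
    calc b / 2 ≤ ∫ y, g y / 2 ∂(cubeMeasure d) := by rw [integral_div]; linarith
      _ ≤ _ := by
          refine integral_mono ((integrable_cubeMeasure hg).div_const 2) (hi1.sub hi2) fun y => ?_
          have := hnn y
          simp only
          nlinarith
  have hsup : ∀ f ∈ realKorobovClass d r, ENNReal.ofReal |E f| ≤
      ⨆ f ∈ realKorobovClass d r, ENNReal.ofReal |(∫ x, ‖f x‖ ^ (2 : ℝ) ∂(cubeMeasure d)) -
        ∑ j, w j * ‖f (ξ j)‖ ^ (2 : ℝ)| := fun f hf =>
    le_iSup₂ (f := fun f (_ : f ∈ realKorobovClass d r) =>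
      ENNReal.ofReal |(∫ x, ‖f x‖ ^ (2 : ℝ) ∂(cubeMeasure d)) -
        ∑ j, w j * ‖f (ξ j)‖ ^ (2 : ℝ)|) f hf
  set e1 := E (fun y => (((1 + g y) / 2 : ℝ) : ℂ)) with he1
  set e0 := E (fun _ => (((1 + 0) / 2 : ℝ) : ℂ)) with he0
  have h12 : b / 4 ≤ |e1| ∨ b / 4 ≤ |e0| := by
    by_contra! hcon
    have h1 := le_abs_self e1
    have h2 := neg_abs_le e0
    linarith
  rcases h12 with h1 | h1
  · exact (ENNReal.ofReal_le_ofReal h1).trans (hsup _ hmem1)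
  · exact (ENNReal.ofReal_le_ofReal h1).trans (hsup _ hmem0)

/-- The lower bound for the optimal discretization error on the real Korobov class. -/
theorem exists_rpow_mul_log_le_optimalDiscretizationError (hd : 1 ≤ d) {r : ℝ} (hr : 1 < r) :
    ∃ c : ℝ, 0 < c ∧ ∀ m : ℕ, 2 ≤ m →
      ENNReal.ofReal (c * ((m : ℝ) ^ (-r) * Real.log m ^ (d - 1))) ≤
        optimalDiscretizationError (cube d) (cubeMeasure d) 2 (realKorobovClass d r) m := by
  obtain ⟨c, hc, hfool⟩ := exists_fooling_function hd hr
  refine ⟨c * 2 ^ (-r) / 4, by positivity, fun m hm => ?_⟩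
  have hm0 : (0 : ℝ) < m := by positivity
  -- The least `n` with `m < 2^n`. Then `2^n ≤ 2m`, which costs the factor `2^(-r)`, and `log m ≤ n`
  -- because `log 2 ≤ 1`.
  set n := Nat.log 2 m + 1 with hn
  have hlt : m < 2 ^ n := Nat.lt_pow_succ_log_self one_lt_two m
  have hle : (2 : ℝ) ^ n ≤ 2 * m := by
    have h1 : 2 ^ n ≤ 2 * m := by
      rw [hn, pow_succ, mul_comm]
      exact Nat.mul_le_mul_left 2 (Nat.pow_log_le_self 2 (by omega))
    exact_mod_cast h1
  have hlog : Real.log m ≤ n := by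
    have h1 : Real.log m ≤ Real.log (2 ^ n) :=
      Real.log_le_log hm0 (by exact_mod_cast hlt.le)
    rw [Real.log_pow] at h1
    have h2 : Real.log 2 ≤ 1 := by
      have := Real.log_two_lt_d9; linarith
    have h3 : (0 : ℝ) ≤ n := by positivity
    nlinarith
  have hlog0 : 0 ≤ Real.log m := Real.log_nonneg (by exact_mod_cast (by omega : 1 ≤ m))
  refine le_trans ?_ (ofReal_le_optimalDiscretizationError fun x => hfool n m hlt x)
  apply ENNReal.ofReal_le_ofReal
  have h1 := Real.rpow_le_rpow_of_nonpos (by positivity) hle (by linarith : -r ≤ 0)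
  rw [Real.mul_rpow (by norm_num) hm0.le] at h1
  calc c * 2 ^ (-r) / 4 * ((m : ℝ) ^ (-r) * Real.log m ^ (d - 1))
      = c * ((2 ^ (-r) * (m : ℝ) ^ (-r)) * Real.log m ^ (d - 1)) / 4 := by ring
    _ ≤ c * (((2 : ℝ) ^ n) ^ (-r) * (n : ℝ) ^ (d - 1)) / 4 := by gcongr

end LowerBound

theorem optimalDiscretizationError_mono {X : Type*} [MeasurableSpace X] (Ω : Set X)
    (μ : Measure X) (q : ℝ) {W W' : Set (X → ℂ)} (h : W ⊆ W') (m : ℕ) :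
    optimalDiscretizationError Ω μ q W m ≤ optimalDiscretizationError Ω μ q W' m :=
  iInf_mono fun _ => iInf_mono fun _ => biSup_mono fun _ hf => h hf

theorem mainTheorem4 (d : ℕ) (hd : 1 ≤ d) (r : ℝ) (hr : 1 < r) :
    ∃ c C : ℝ, 0 < c ∧ 0 < C ∧
      ∀ W : Set ((Fin d → ℝ) → ℂ), W = korobovClass d r ∨ W = realKorobovClass d r →
        ∀ m : ℕ, 2 ≤ m →
          ENNReal.ofReal (c * ((m : ℝ) ^ (-r) * Real.log m ^ (d - 1))) ≤
              optimalDiscretizationError (cube d) (cubeMeasure d) 2 W m ∧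
            optimalDiscretizationError (cube d) (cubeMeasure d) 2 W m ≤
              ENNReal.ofReal (C * ((m : ℝ) ^ (-r) * Real.log m ^ (d - 1))) := by
  obtain ⟨c, hc, hlow⟩ := exists_rpow_mul_log_le_optimalDiscretizationError hd hr
  obtain ⟨C, hC, hup⟩ := exists_optimalDiscretizationError_le_rpow_mul_log hd hr
  have hsub : realKorobovClass d r ⊆ korobovClass d r := fun f hf => hf.1
  refine ⟨c, C, hc, hC, fun W hW m hm => ?_⟩
  rcases hW with rfl | rfl
  · exact ⟨(hlow m hm).trans (optimalDiscretizationError_mono _ _ _ hsub m), hup m hm⟩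
  · exact ⟨hlow m hm, (optimalDiscretizationError_mono _ _ _ hsub m).trans (hup m hm)⟩
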